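/- **Setting.** Let $S$ be a connected closed surface with a finite non-empty vertex set $V$ and a fixed triangulation $\mathcal T=(V,E,F)$ (a gluing of finitely many triangles along their sides in pairs; loops and multiple edges are allowed). A decorated piecewise hyperbolic (PH) metric $(l,r)$ on $(S,V,\mathcal T)$ consists of edge lengths $l:E\to\mathbb R_{>0}$ satisfying the strict triangle inequalities in every face and radii $r:V\to\mathbb R_{>0}$ with $l_{ij}>r_i+r_j$ for every edge $\{ij\}$. Fix such an $(l,r)$ and its inversive distances $$I_{ij}=\frac{\cosh l_{ij}-\cosh r_i\cosh r_j}{\sinh r_i\sinh r_j}.$$ For $h\in\mathbb R_{>0}^V$ let $r_i(h)>0$ be defined by $h_i=-\ln\tanh\frac{r_i(h)}2$, and $l_{ij}(h)>0$ by $\cosh l_{ij}(h)=\cosh r_i(h)\cosh r_j(h)+I_{ij}\sinh r_i(h)\sinh r_j(h)$. The admissible space $\Omega^{\mathcal T}\subset\mathbb R^V_{>0}$ is the set of those $h$ (discrete conformal factors) for which $l(h)$ satisfies the strict triangle inequalities in every face. For $h\in\Omega^{\mathcal T}$ let $K_i(h)=2\pi-\theta_i(h)$, where $\theta_i(h)$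 is the sum of the angles at $i$ of the hyperbolic triangles with side lengths $l(h)$. For a constant $\alpha\in\mathbb R$ the combinatorial $\alpha$-curvature of $(l(h),r(h))$ is $R_{\alpha,i}(h)=K_i(h)/e^{\alpha h_i}$, and the discrete $\alpha$-Laplace operator is $\Delta^{\mathcal T}_\alpha f_i=e^{-\alpha h_i}\sum_{j\in V}\frac{\partial K_i}{\partial h_j}f_j$. Given $\overline R:V\to\mathbb R$, the combinatorial $\alpha$-Ricci flow and the combinatorial $\alpha$-Calabi flow are the following systems of ordinary differential equations in $\Omega^{\mathcal T}$: $$\frac{dh_i}{dt}=R_{\alpha,i}-\overline R_i,\qquad\qquad \frac{dh_i}{dt}=\Delta^{\mathcal T}_\alpha(\overline R-R_\alpha)_i .$$ **Theorem.** Let $\alpha\in\mathbb R$ and $\overline R:V\to\mathbb R$. (i) If a solution $h:[0,\infty)\to\Omega^{\mathcal T}$ of the $\alpha$-Ricci flow or of the $\alpha$-Calabi flow converges, as $t\to\infty$, to a point $\overline h\in\Omega^{\mathcal T}$, then $(l(\overline h),r(\overline h))$ has combinatorial $\alpha$-curvature $\overline R$. (ii) Suppose that $\overline h\in\Omega^{\mathcal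 T}$ is such that $(l(\overline h),r(\overline h))$ has combinatorial $\alpha$-curvature $\overline R$, and that $\alpha\overline R_i\ge0$ for all $i\in V$. Then there are a neighbourhood $U$ of $\overline h$ and constants $\delta,C,c>0$ such that for every $h_0\in\Omega^{\mathcal T}\cap U$ with $\|R_\alpha(h_0)-R_\alpha(\overline h)\|<\delta$ both the $\alpha$-Ricci flow and the $\alpha$-Calabi flow with $h(0)=h_0$ have a unique solution in $\Omega^{\mathcal T}$, it exists for all $t\ge0$, and $\|h(t)-\overline h\|\le Ce^{-ct}$ for all $t\ge0$. If $\alpha\le0$, or if $\overline R_i>0$ for all $i\in V$, one can take $U=\mathbb R^V$, that is, closeness in curvature alone suffices. -/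

import Mathlib

open Set Filter Topology

noncomputable section

/-- A triangulation (a gluing of finitely many triangles along their sides in pairs; loops, multiple
edges and triangles with identified vertices or sides are allowed) of a connected closed surface,
with set of vertices `V`, of edges `E` and of faces `F`.
The three corners of a face are numbered by `Fin 3`, and side `b` is the side opposite to corner `b`.
Side `b` of `f` is glued to the side `perm f b b` of the face `adj f b`, and for `a ≠ b` the endpoint
`a` of the first side is glued to the endpoint `perm f b a` of the second one. A vertex is a class of
corners, an edge is a class of sides under the gluing. -/
structure SurfaceTriangulation (V E F : Type*) where
  adj : F → Fin 3 → F
  perm : F → Fin 3 → Equiv.Perm (Fin 3)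
  adj_adj : ∀ f b, adj (adj f b) (perm f b b) = f
  perm_perm : ∀ f b, perm (adj f b) (perm f b b) = (perm f b).symm
  /-- no side is glued to itself, so that the surface has no boundary -/
  ne_self : ∀ f b, (adj f b, perm f b b) ≠ (f, b)
  vert : F → Fin 3 → V
  vert_surjective : ∀ i : V, ∃ f a, vert f a = i
  vert_eq_iff : ∀ f a f' a', vert f a = vert f' a' ↔
    Relation.EqvGen
      (fun p q : F × Fin 3 => ∃ b, b ≠ p.2 ∧ q = (adj p.1 b, perm p.1 b p.2)) (f, a) (f', a')
  edge : F → Fin 3 → E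
  edge_surjective : ∀ e : E, ∃ f b, edge f b = e
  edge_eq_iff : ∀ f b f' b', edge f b = edge f' b' ↔
    ((f', b') = (f, b) ∨ (f', b') = (adj f b, perm f b b))
  nonempty : Nonempty F
  connected : ∀ f f' : F, Relation.ReflTransGen (fun g g' => ∃ b, g' = adj g b) f f'

/-- A decorated piecewise hyperbolic metric on a triangulated surface: edge lengths `l` that satisfy
the strict triangle inequalities in each face, and radii `r` of the vertex-circles such that the
vertex-circles at the two ends of each edge are separated. -/
structure DecoratedPHMetric {V E F : Type*} (T : SurfaceTriangulation V E F) where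
  l : E → ℝ
  r : V → ℝ
  l_pos : ∀ e, 0 < l e
  r_pos : ∀ i, 0 < r i
  triangle : ∀ f a, l (T.edge f a) < l (T.edge f (a + 1)) + l (T.edge f (a + 2))
  separated : ∀ f a, r (T.vert f (a + 1)) + r (T.vert f (a + 2)) < l (T.edge f a)

namespace DecoratedPHMetric

variable {V E F : Type*} {T : SurfaceTriangulation V E F} (M : DecoratedPHMetric T)

/-- The inversive distance of the two vertex-circles at the ends of side `a` of the face `f`. -/
def inversiveDistance (f : F) (a : Fin 3) : ℝ :=
  (Real.cosh (M.l (T.edge f a))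
      - Real.cosh (M.r (T.vert f (a + 1))) * Real.cosh (M.r (T.vert f (a + 2))))
    / (Real.sinh (M.r (T.vert f (a + 1))) * Real.sinh (M.r (T.vert f (a + 2))))

/-- The radius `r_i` with `h_i = - ln (tanh (r_i / 2))`, for `h_i > 0`. -/
def radius (h : V → ℝ) (i : V) : ℝ := 2 * Real.artanh (Real.exp (-h i))

/-- The length of side `a` of the face `f` in the decorated metric `(l(h), r(h))` with radii `r(h)`
and the same inversive distances as `(l, r)`. -/
def sideLength (h : V → ℝ) (f : F) (a : Fin 3) : ℝ :=
  Real.arcosh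
    (Real.cosh (radius h (T.vert f (a + 1))) * Real.cosh (radius h (T.vert f (a + 2)))
      + M.inversiveDistance f a
        * (Real.sinh (radius h (T.vert f (a + 1))) * Real.sinh (radius h (T.vert f (a + 2)))))

/-- The admissible space of the discrete conformal factors `h`. -/
def admissible : Set (V → ℝ) :=
  {h | (∀ i, 0 < h i) ∧
    ∀ f a, M.sideLength h f a < M.sideLength h f (a + 1) + M.sideLength h f (a + 2)}

/-- The inner angle at corner `a` of the hyperbolic triangle `f` in `(l(h), r(h))`. -/
def angle (h : V → ℝ) (f : F) (a : Fin 3) : ℝ :=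
  Real.arccos
    ((Real.cosh (M.sideLength h f (a + 1)) * Real.cosh (M.sideLength h f (a + 2))
        - Real.cosh (M.sideLength h f a))
      / (Real.sinh (M.sideLength h f (a + 1)) * Real.sinh (M.sideLength h f (a + 2))))

open Classical in
/-- The angle defect `K_i` of `(l(h), r(h))`. -/
def angleDefect [Fintype F] (h : V → ℝ) (i : V) : ℝ :=
  2 * Real.pi - ∑ f : F, ∑ a : Fin 3, if T.vert f a = i then M.angle h f a else 0

/-- The combinatorial `α`-curvature `R_{α,i}` of `(l(h), r(h))`. -/
def alphaCurvature [Fintype F] (α : ℝ) (h : V → ℝ) (i : V) : ℝ :=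
  M.angleDefect h i / Real.exp (α * h i)

open Classical in
/-- The partial derivative `∂K_i / ∂h_j`. -/
def angleDefectPartial [Fintype V] [Fintype F] (h : V → ℝ) (i j : V) : ℝ :=
  fderiv ℝ (fun x : V → ℝ => M.angleDefect x i) h (Pi.single j 1)

/-- The discrete `α`-Laplace operator at `h`. -/
def alphaLaplace [Fintype V] [Fintype F] (α : ℝ) (h : V → ℝ) (φ : V → ℝ) (i : V) : ℝ :=
  1 / Real.exp (α * h i) * ∑ j : V, M.angleDefectPartial h i j * φ j

/-- The right-hand side of the combinatorial `α`-Ricci flow. -/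
def ricciField [Fintype F] (α : ℝ) (Rbar : V → ℝ) (h : V → ℝ) : V → ℝ :=
  fun i => M.alphaCurvature α h i - Rbar i

/-- The right-hand side of the combinatorial `α`-Calabi flow. -/
def calabiField [Fintype V] [Fintype F] (α : ℝ) (Rbar : V → ℝ) (h : V → ℝ) : V → ℝ :=
  fun i => M.alphaLaplace α h (fun j => Rbar j - M.alphaCurvature α h j) i

/-- `h` solves `dh/dt = X(h)` on the time set `J`, staying in the admissible space. -/
def IsSolutionOn [Fintype V] (X : (V → ℝ) → V → ℝ) (J : Set ℝ) (h : ℝ → V → ℝ) : Prop :=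
  ∀ t ∈ J, h t ∈ M.admissible ∧ HasDerivWithinAt h (X (h t)) J t

end DecoratedPHMetric

end

/-!
In a triangle write `c a = cosh (l a)`, `x a = cosh (r a) = coth (h a)`. Differentiating
`cosh l = cosh r cosh r' + I sinh r sinh r'` at fixed `I` and then the law of cosines, the
variation of the three angles is `D ^ (-1/2) • angleVar c x v`, where `D = gramDet c` is the Gram
determinant of the vertices in the hyperboloid model. The operator `angleVar c x` is symmetric, and
it is linear in `x`. It is injective as soon as `x b < x a * c` along every oriented side
(`FeetInside`): the angles determine the sides infinitesimally, and a radius variation that fixes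
the three sides would have to change sign along each of them. These inequalities define a convex
cone, which contains the vector `x` of the incentre, where positivity is seen directly. A symmetric
pencil that never degenerates stays positive (`dotProduct_pos_of_pencil`), so `angleVar c x` is
positive definite (`angleVar_pos`). Summing over the faces, the Jacobian `∂K/∂h` of the angle
defects is symmetric and negative definite on the admissible space.

With `L = ∂K/∂h` at a point where `R_α = R̄`, the form `S = -L + diag (α K)` is symmetric and, as
`α R̄ ≥ 0`, positive definite. The Ricci field has derivative `-A S` and the Calabi field `A L A S`
there, with `A = diag (exp (-α h))`, so `v ⬝ᵥ S v` is a strict Lyapunov function for both flows.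
Together with the Picard-Lindelöf theorem this gives the local statement
(`exists_exponentially_stable`).

That closeness of curvatures suffices comes from a global monotonicity. As `arccos` is constant
outside `[-1, 1]`, the angles extend continuously to all `h > 0`, and they equal `0` or `π` at
degenerate triangles. Along a segment with direction `v`, the angles of a face paired with `v` are
therefore a continuous function, with nonnegative derivative at the nondegenerate times and finitely
many values at the others; hence it is monotone, and `v ⬝ᵥ K` is antitone. This yields
`(h - h̄) ⬝ᵥ (K h - K h̄) ≤ -m ‖h - h̄‖` away from `h̄`, which contradicts closeness of `R_α`.

In part (i) the limit is a zero of the field, and a zero of the Calabi field is a zero of the Ricci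
field as `L` is injective.
-/

noncomputable section

/-! ### Positivity along a pencil of symmetric operators -/

/-- If `P` is positive definite and no member of the pencil `R + s P`, `s ≥ 0`, degenerates, then
`R` is positive definite: for the minimum `l` of the quotient of the two forms, `R - l P` is
positive semidefinite and degenerate, so `l > 0`. -/
theorem dotProduct_pos_of_pencil {ι : Type*} [Fintype ι] (P R : (ι → ℝ) →ₗ[ℝ] (ι → ℝ))
    (hP : ∀ v, v ≠ 0 → 0 < v ⬝ᵥ P v)
    (hPs : ∀ v w, v ⬝ᵥ P w = w ⬝ᵥ P v) (hRs : ∀ v w, v ⬝ᵥ R w = w ⬝ᵥ R v)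
    (hinj : ∀ s : ℝ, 0 ≤ s → ∀ v, R v + s • P v = 0 → v = 0) :
    ∀ v, v ≠ 0 → 0 < v ⬝ᵥ R v := by
  intro v₀ hv₀
  by_contra! hneg
  have hPc : Continuous P := LinearMap.continuous_of_finiteDimensional P
  have hRc : Continuous R := LinearMap.continuous_of_finiteDimensional R
  have hne : ∀ v ∈ Metric.sphere (0 : ι → ℝ) 1, v ≠ 0 := fun v hv => by
    rintro rfl; simp at hv
  obtain ⟨u, hu, hmin⟩ := (isCompact_sphere (0 : ι → ℝ) 1).exists_isMinOn
    (f := fun v => (v ⬝ᵥ R v) / (v ⬝ᵥ P v))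
    ⟨‖v₀‖⁻¹ • v₀, by simp [norm_smul, norm_ne_zero_iff.2 hv₀]⟩
    (ContinuousOn.div (by fun_prop) (by fun_prop) fun v hv => (hP v (hne v hv)).ne')
  set l := (u ⬝ᵥ R u) / (u ⬝ᵥ P u) with hl
  have hall : ∀ v, 0 ≤ v ⬝ᵥ R v - l * (v ⬝ᵥ P v) := by
    intro v
    by_cases hv : v = 0
    · simp [hv]
    have h1 : l ≤ _ := hmin (show ‖v‖⁻¹ • v ∈ Metric.sphere (0 : ι → ℝ) 1 by
      simp [norm_smul, norm_ne_zero_iff.2 hv])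
    have hn : ‖v‖⁻¹ ≠ 0 := inv_ne_zero (norm_ne_zero_iff.2 hv)
    simp only [map_smul, smul_dotProduct, dotProduct_smul, smul_eq_mul] at h1
    rw [mul_div_mul_left _ _ hn, mul_div_mul_left _ _ hn, le_div_iff₀ (hP v hv)] at h1
    linarith
  have hlu : u ⬝ᵥ R u - l * (u ⬝ᵥ P u) = 0 := by
    rw [hl, div_mul_cancel₀ _ (hP u (hne u hu)).ne', sub_self]
  have hl0 : l ≤ 0 := by
    have h1 := hall v₀
    have h2 := hP v₀ hv₀
    by_contra! h
    nlinarith [mul_pos h h2]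
  -- a null vector of a positive semidefinite form lies in its kernel
  set w := R u - l • P u with hw
  have hdisc : ∀ t : ℝ, 0 ≤ 2 * t * (w ⬝ᵥ w) + t ^ 2 * (w ⬝ᵥ R w - l * (w ⬝ᵥ P w)) := by
    intro t
    have h1 := hall (u + t • w)
    simp only [map_add, map_smul, smul_dotProduct, dotProduct_smul, smul_eq_mul, add_dotProduct,
      dotProduct_add] at h1
    have h2 : w ⬝ᵥ w = w ⬝ᵥ R u - l * (w ⬝ᵥ P u) := by
      conv_lhs => rw [hw]
      rw [← hw, dotProduct_sub, dotProduct_smul, smul_eq_mul]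
    rw [hRs u w, hPs u w] at h1
    rw [h2]
    linarith [h1, hlu]
  have hww : w ⬝ᵥ w = 0 := by
    have hq := hall w
    set q := w ⬝ᵥ R w - l * (w ⬝ᵥ P w)
    have hp : 0 ≤ w ⬝ᵥ w := Finset.sum_nonneg fun i _ => mul_self_nonneg (w i)
    by_contra hne0
    have hp' : 0 < w ⬝ᵥ w := lt_of_le_of_ne hp (Ne.symm hne0)
    have h1 := hdisc (-(w ⬝ᵥ w) / (q + 1))
    have hq1 : 0 < q + 1 := by linarith
    have h2 : 2 * (-(w ⬝ᵥ w) / (q + 1)) * (w ⬝ᵥ w) + (-(w ⬝ᵥ w) / (q + 1)) ^ 2 * q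
        = -((w ⬝ᵥ w) ^ 2 * (q + 2)) / (q + 1) ^ 2 := by
      field_simp
      ring
    rw [h2] at h1
    have : -((w ⬝ᵥ w) ^ 2 * (q + 2)) / (q + 1) ^ 2 < 0 :=
      div_neg_of_neg_of_pos (by nlinarith [pow_pos hp' 2]) (by positivity)
    linarith
  have hw0 : w = 0 := dotProduct_self_eq_zero.1 hww
  refine hne u hu (hinj (-l) (by linarith) u ?_)
  rw [← hw0, hw]; module

/-! ### Positivity of the angle variation in a hyperbolic triangle -/

namespace HyperbolicTriangle

/-- The Gram determinant of the three vertices in the hyperboloid model, where `c a` is the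
hyperbolic cosine of the side opposite to `a`. For `c > 1` it is positive if and only if the
strict triangle inequalities hold. -/
def gramDet (c : Fin 3 → ℝ) : ℝ := 1 + 2 * c 0 * c 1 * c 2 - c 0 ^ 2 - c 1 ^ 2 - c 2 ^ 2

theorem gramDet_eq (c : Fin 3 → ℝ) (a : Fin 3) :
    gramDet c = (c (a + 1) ^ 2 - 1) * (c (a + 2) ^ 2 - 1) - (c (a + 1) * c (a + 2) - c a) ^ 2 := by
  unfold gramDet
  fin_cases a <;> simp <;> ring

/-- The variation of the hyperbolic cosines of the sides when the factors `h` vary by `v`; here `c`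
are the cosines of the sides and `x` those of the radii. -/
def coshVar (c x v : Fin 3 → ℝ) (a : Fin 3) : ℝ :=
  -((x (a + 1) * c a - x (a + 2)) * v (a + 1) + (x (a + 2) * c a - x (a + 1)) * v (a + 2))

/-- `√(gramDet c)` times the variation of the angles when the hyperbolic cosines `c` of the sides
vary by `u`. -/
def angleVarOfSides (c u : Fin 3 → ℝ) (a : Fin 3) : ℝ :=
  u a - (c a * c (a + 1) - c (a + 2)) * (u (a + 1) / (c (a + 1) ^ 2 - 1))
    - (c a * c (a + 2) - c (a + 1)) * (u (a + 2) / (c (a + 2) ^ 2 - 1))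

/-- The off-diagonal entry of `angleVar c x` for the two ends of side `e`. -/
def edgeWeight (c x : Fin 3 → ℝ) (e : Fin 3) : ℝ :=
  (x e * (c e ^ 2 - 1) + x (e + 1) * (c (e + 2) - c (e + 1) * c e)
    + x (e + 2) * (c (e + 1) - c (e + 2) * c e)) / (c e ^ 2 - 1)

/-- The matrix of `angleVar c x` is symmetric with off-diagonal entries `edgeWeight`, and each row
is orthogonal to the corresponding row of the Gram matrix. -/
theorem angleVar_eq_edgeWeight {c : Fin 3 → ℝ} (hc : ∀ a, 1 < c a) (x v : Fin 3 → ℝ) (a : Fin 3) :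
    angleVarOfSides c (coshVar c x v) a =
      edgeWeight c x (a + 1) * (v (a + 2) - c (a + 1) * v a)
        + edgeWeight c x (a + 2) * (v (a + 1) - c (a + 2) * v a) := by
  have h : ∀ a, c a ^ 2 - 1 ≠ 0 := fun a => by nlinarith [hc a]
  have h0 := h 0
  have h1 := h 1
  have h2 := h 2
  unfold angleVarOfSides coshVar edgeWeight
  fin_cases a <;> simp <;> field_simp <;> ring

/-- `√(gramDet c)` times the variation of the angles as a function of that of the factors. -/
def angleVar (c x : Fin 3 → ℝ) : (Fin 3 → ℝ) →ₗ[ℝ] (Fin 3 → ℝ) where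
  toFun v := angleVarOfSides c (coshVar c x v)
  map_add' v w := by
    funext a; simp only [angleVarOfSides, coshVar, Pi.add_apply]; ring
  map_smul' t v := by
    funext a; simp only [angleVarOfSides, coshVar, Pi.smul_apply, smul_eq_mul, RingHom.id_apply]
    ring

theorem angleVar_apply (c x v : Fin 3 → ℝ) :
    angleVar c x v = angleVarOfSides c (coshVar c x v) := rfl

theorem angleVar_add_smul (c x y v : Fin 3 → ℝ) (s : ℝ) :
    angleVar c (x + s • y) v = angleVar c x v + s • angleVar c y v := by
  funext a
  simp only [angleVar_apply, angleVarOfSides, coshVar, Pi.add_apply, Pi.smul_apply, smul_eq_mul]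
  ring

theorem angleVar_symm {c : Fin 3 → ℝ} (hc : ∀ a, 1 < c a) (x v w : Fin 3 → ℝ) :
    v ⬝ᵥ angleVar c x w = w ⬝ᵥ angleVar c x v := by
  simp only [dotProduct, Fin.sum_univ_three, angleVar_apply, angleVar_eq_edgeWeight hc]
  simp
  ring

/-- Each foot of the perpendiculars from the radical centre to the sides lies strictly inside its
side. Equivalently, growing a vertex-circle lengthens both adjacent sides. -/
def FeetInside (c x : Fin 3 → ℝ) : Prop :=
  ∀ a, x (a + 2) < x (a + 1) * c a ∧ x (a + 1) < x (a + 2) * c a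

/-- The angles determine the sides infinitesimally: `angleVarOfSides` is, up to sign and a
diagonal factor, the adjugate of the Gram matrix. -/
theorem angleVarOfSides_eq_zero {c u : Fin 3 → ℝ} (hc : ∀ a, 1 < c a) (hD : 0 < gramDet c)
    (h : angleVarOfSides c u = 0) : u = 0 := by
  have hs : ∀ a, c a ^ 2 - 1 ≠ 0 := fun a => by nlinarith [hc a]
  have key : ∀ a, gramDet c * (u a / (c a ^ 2 - 1)) = -(angleVarOfSides c u a
      + c (a + 2) * angleVarOfSides c u (a + 1) + c (a + 1) * angleVarOfSides c u (a + 2)) := by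
    have h0 := hs 0
    have h1 := hs 1
    have h2 := hs 2
    intro a
    unfold gramDet angleVarOfSides
    fin_cases a <;> simp <;> field_simp <;> ring
  funext a
  have h1 := key a
  rw [h] at h1
  simp only [Pi.zero_apply, mul_zero, add_zero, neg_zero, mul_eq_zero, hD.ne',
    div_eq_zero_iff, hs a, or_false, false_or] at h1
  exact h1

/-- If the sides are fixed, then `v` takes opposite signs at the two ends of each of the three
sides, so it vanishes. -/
theorem coshVar_eq_zero {c x v : Fin 3 → ℝ} (hx : FeetInside c x) (h : coshVar c x v = 0) :
    v = 0 := by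
  have sgn : ∀ p q s t : ℝ, 0 < p → 0 < q → p * s + q * t = 0 →
      (0 < s → t < 0) ∧ (s < 0 → 0 < t) := by
    intro p q s t hp hq h
    constructor <;> intro hs <;> by_contra! ht
    · nlinarith [mul_pos hp hs, mul_nonneg hq.le ht]
    · nlinarith [mul_pos hp (neg_pos.2 hs), mul_nonneg hq.le (neg_nonneg.2 ht)]
  have e : ∀ a, (0 < v (a + 1) → v (a + 2) < 0) ∧ (v (a + 1) < 0 → 0 < v (a + 2)) := by
    intro a
    have h1 := congrFun h a
    simp only [coshVar, Pi.zero_apply, neg_eq_zero] at h1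
    exact sgn _ _ _ _ (sub_pos.2 (hx a).1) (sub_pos.2 (hx a).2) h1
  have e0 := e 0
  have e1 := e 1
  have e2 := e 2
  simp at e0 e1 e2
  funext a
  have : v 0 = 0 ∧ v 1 = 0 ∧ v 2 = 0 := by
    refine ⟨?_, ?_, ?_⟩ <;> by_contra hne <;>
      rcases lt_or_gt_of_ne hne with hlt | hlt <;> grind
  fin_cases a <;> simp [this]

theorem angleVar_injective {c x v : Fin 3 → ℝ} (hc : ∀ a, 1 < c a) (hD : 0 < gramDet c)
    (hx : FeetInside c x) (h : angleVar c x v = 0) : v = 0 :=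
  coshVar_eq_zero hx (angleVarOfSides_eq_zero hc hD h)

/-- The values `x` for which the radical centre is the incentre, up to scale: the Gram matrix
applied to the barycentric coordinates `s`, the hyperbolic sines of the sides. -/
def incenter (c s : Fin 3 → ℝ) (a : Fin 3) : ℝ :=
  s a + c (a + 2) * s (a + 1) + c (a + 1) * s (a + 2)

theorem feetInside_incenter {c s : Fin 3 → ℝ} (hD : 0 < gramDet c)
    (hs : ∀ a, 0 < s a) (hsc : ∀ a, s a ^ 2 = c a ^ 2 - 1) : FeetInside c (incenter c s) := by
  -- the cosine of each angle is greater than `-1`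
  have hlt : ∀ a, -(s (a + 1) * s (a + 2)) < c (a + 1) * c (a + 2) - c a := by
    intro a
    have h1 := gramDet_eq c a
    rw [← hsc, ← hsc] at h1
    exact (abs_lt.1 (abs_lt_of_sq_lt_sq (by nlinarith)
      (mul_pos (hs (a + 1)) (hs (a + 2))).le)).1
  intro a
  have e1 : a + 1 + 1 = a + 2 := by fin_cases a <;> rfl
  have e2 : a + 1 + 2 = a := by fin_cases a <;> rfl
  have e3 : a + 2 + 1 = a := by fin_cases a <;> rfl
  have e4 : a + 2 + 2 = a + 1 := by fin_cases a <;> rfl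
  have h1 := hlt (a + 1)
  have h2 := hlt (a + 2)
  simp only [e1, e2, e3, e4] at h1 h2
  simp only [incenter, e1, e2, e3, e4]
  constructor
  · have := mul_pos (hs a) (sub_pos.2 h1)
    linear_combination this + s (a + 2) * hsc a
  · have := mul_pos (hs a) (sub_pos.2 h2)
    linear_combination this + s (a + 1) * hsc a

theorem angleVar_incenter_pos {c s : Fin 3 → ℝ} (hc : ∀ a, 1 < c a) (hD : 0 < gramDet c)
    (hs : ∀ a, 0 < s a) (hsc : ∀ a, s a ^ 2 = c a ^ 2 - 1) {v : Fin 3 → ℝ} (hv : v ≠ 0) :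
    0 < v ⬝ᵥ angleVar c (incenter c s) v := by
  have hw : ∀ e, edgeWeight c (incenter c s) e = -(gramDet c / s e) := by
    intro e
    have h0 : s e ≠ 0 := (hs e).ne'
    unfold edgeWeight
    rw [← hsc, div_eq_iff (pow_ne_zero 2 h0)]
    have : -(gramDet c / s e) * s e ^ 2 = -(gramDet c * s e) := by field_simp
    rw [this, hsc]
    unfold gramDet incenter
    fin_cases e <;> simp <;> ring
  have hk : ∀ e, 0 < gramDet c / s e := fun e => div_pos hD (hs e)
  have hQ : v ⬝ᵥ angleVar c (incenter c s) v =
      ∑ e, gramDet c / s e *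
        (c e * (v (e + 1) ^ 2 + v (e + 2) ^ 2) - 2 * v (e + 1) * v (e + 2)) := by
    simp only [dotProduct, Fin.sum_univ_three, angleVar_apply, angleVar_eq_edgeWeight hc, hw]
    simp
    ring
  have hterm : ∀ e, gramDet c / s e * ((c e - 1) * (v (e + 1) ^ 2 + v (e + 2) ^ 2)) ≤
      gramDet c / s e * (c e * (v (e + 1) ^ 2 + v (e + 2) ^ 2) - 2 * v (e + 1) * v (e + 2)) := by
    intro e
    refine mul_le_mul_of_nonneg_left ?_ (hk e).le
    nlinarith [sq_nonneg (v (e + 1) - v (e + 2))]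
  rw [hQ]
  refine lt_of_lt_of_le ?_ (Finset.sum_le_sum fun e _ => hterm e)
  obtain ⟨a, ha⟩ := Function.ne_iff.1 hv
  refine Finset.sum_pos' (fun e _ => mul_nonneg (hk e).le
    (mul_nonneg (by linarith [hc e]) (by positivity))) ⟨a + 2, Finset.mem_univ _, ?_⟩
  refine mul_pos (hk _) (mul_pos (by linarith [hc (a + 2)]) ?_)
  have : a + 2 + 1 = a := by fin_cases a <;> rfl
  rw [this]
  have : 0 < v a ^ 2 := by simpa using pow_pos (abs_pos.2 ha) 2
  positivity

theorem angleVar_pos {c x v : Fin 3 → ℝ} (hc : ∀ a, 1 < c a) (hD : 0 < gramDet c)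
    (hx : FeetInside c x) (hv : v ≠ 0) : 0 < v ⬝ᵥ angleVar c x v := by
  have hp : ∀ a, 0 < c a ^ 2 - 1 := fun a => by nlinarith [hc a]
  set s : Fin 3 → ℝ := fun a => √(c a ^ 2 - 1)
  have hs : ∀ a, 0 < s a := fun a => Real.sqrt_pos.2 (hp a)
  have hsc : ∀ a, s a ^ 2 = c a ^ 2 - 1 := fun a => Real.sq_sqrt (hp a).le
  refine dotProduct_pos_of_pencil (angleVar c (incenter c s)) (angleVar c x)
    (fun v hv => angleVar_incenter_pos hc hD hs hsc hv) (angleVar_symm hc _) (angleVar_symm hc _)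
    (fun t ht w hw => ?_) v hv
  rw [← angleVar_add_smul] at hw
  refine angleVar_injective hc hD (fun a => ?_) hw
  have h1 := hx a
  have h2 := feetInside_incenter hD hs hsc a
  simp only [Pi.add_apply, Pi.smul_apply, smul_eq_mul]
  constructor
  · nlinarith [h1.1, mul_le_mul_of_nonneg_left h2.1.le ht]
  · nlinarith [h1.2, mul_le_mul_of_nonneg_left h2.2.le ht]

end HyperbolicTriangle

/-! ### Monotonicity of functions with finitely many exceptional values -/

/-- A continuous function is monotone if its derivative is nonnegative on a set of times and it
takes only finitely many values at the other times: a decrease would cross an interval of levels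
which is only attained at times of the first kind. -/
theorem monotoneOn_of_deriv_nonneg_of_finite {f : ℝ → ℝ} {a b : ℝ} {O : Set ℝ} {S : Set ℝ}
    (hf : ContinuousOn f (Icc a b)) (hS : S.Finite)
    (hO : ∀ t ∈ Icc a b, t ∈ O → ∃ f', HasDerivAt f f' t ∧ 0 ≤ f')
    (hfS : ∀ t ∈ Icc a b, t ∉ O → f t ∈ S) : MonotoneOn f (Icc a b) := by
  intro x hx y hy hxy
  by_contra! hlt
  -- levels `p < q` between `f y` and `f x` with no value of `S` in `[p, q]`
  obtain ⟨p, q, hp, hpq, hq, hpqS⟩ : ∃ p q, f y < p ∧ p < q ∧ q < f x ∧ Icc p q ⊆ Sᶜ := by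
    obtain ⟨m, hm, hmS⟩ := (Ioo_infinite hlt).exists_notMem_finite hS
    have hnhds : Sᶜ ∩ Ioo (f y) (f x) ∈ 𝓝 m :=
      inter_mem (hS.isClosed.isOpen_compl.mem_nhds hmS) (Ioo_mem_nhds hm.1 hm.2)
    obtain ⟨e, he, hsub⟩ := Metric.nhds_basis_closedBall.mem_iff.1 hnhds
    rw [Real.closedBall_eq_Icc] at hsub
    exact ⟨m - e, m + e, (hsub (left_mem_Icc.2 (by linarith))).2.1, by linarith,
      (hsub (right_mem_Icc.2 (by linarith))).2.2, fun z hz => (hsub hz).1⟩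
  have hfxy : ContinuousOn f (Icc x y) := hf.mono (Icc_subset_Icc hx.1 hy.2)
  -- the last time `s` at level at least `q`
  have hcl : IsCompact (Icc x y ∩ f ⁻¹' Ici q) :=
    isCompact_Icc.of_isClosed_subset (hfxy.preimage_isClosed_of_isClosed isClosed_Icc isClosed_Ici)
      inter_subset_left
  obtain ⟨s, ⟨hs, hsq⟩, hsmax⟩ := hcl.exists_isGreatest ⟨x, left_mem_Icc.2 hxy, hq.le⟩
  -- the first later time `t` at level at most `p`
  have hcl' : IsCompact (Icc s y ∩ f ⁻¹' Iic p) :=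
    isCompact_Icc.of_isClosed_subset ((hfxy.mono (Icc_subset_Icc_left
      hs.1)).preimage_isClosed_of_isClosed isClosed_Icc isClosed_Iic) inter_subset_left
  obtain ⟨t, ⟨ht, htp⟩, htmin⟩ := hcl'.exists_isLeast ⟨y, right_mem_Icc.2 hs.2, hp.le⟩
  simp only [mem_preimage, mem_Ici, mem_Iic] at hsq htp
  have hsub : Icc s t ⊆ Icc a b := Icc_subset_Icc (hx.1.trans hs.1) (ht.2.trans hy.2)
  have hmem : ∀ z ∈ Ioo s t, z ∈ O := by
    intro z hz
    by_contra hzO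
    have hzxy : z ∈ Icc x y := ⟨hs.1.trans hz.1.le, hz.2.le.trans ht.2⟩
    have h1 : f z < q := by
      by_contra! h
      exact absurd (hsmax ⟨hzxy, h⟩) (not_le.2 hz.1)
    have h2 : p < f z := by
      by_contra! h
      exact absurd (htmin ⟨⟨hz.1.le, hzxy.2⟩, h⟩) (not_le.2 hz.2)
    exact hpqS ⟨h2.le, h1.le⟩ (hfS z (hsub (Ioo_subset_Icc_self hz)) hzO)
  have hmono : MonotoneOn f (Icc s t) := by
    refine monotoneOn_of_deriv_nonneg (convex_Icc s t) (hf.mono hsub) (fun z hz => ?_)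
      fun z hz => ?_
    all_goals
      rw [interior_Icc] at hz
      obtain ⟨f', h1, h2⟩ := hO z (hsub (Ioo_subset_Icc_self hz)) (hmem z hz)
    · exact h1.differentiableAt.differentiableWithinAt
    · rwa [h1.deriv]
  have := hmono (left_mem_Icc.2 ht.1) (right_mem_Icc.2 ht.1) ht.1
  linarith

theorem isOpen_forall_pos {ι : Type*} [Finite ι] : IsOpen {k : ι → ℝ | ∀ i, 0 < k i} := by
  simp only [ofPred_forall]
  exact isOpen_iInter_of_finite fun i => isOpen_lt continuous_const (continuous_apply i)

/-! ### The angles of a triangle as functions of the conformal factors -/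

namespace HyperbolicTriangle

/-- The hyperbolic cosine of side `a` for the inversive distances `I` and the factors `k`, as
`cosh r = cosh k / sinh k` and `sinh r = 1 / sinh k`. -/
def coshSide (I k : Fin 3 → ℝ) (a : Fin 3) : ℝ :=
  (Real.cosh (k (a + 1)) * Real.cosh (k (a + 2)) + I a)
    / (Real.sinh (k (a + 1)) * Real.sinh (k (a + 2)))

/-- The expression for the cosine of the angle at `a` by the law of cosines. It leaves `(-1, 1)`
when a strict triangle inequality fails. -/
def cosAngle (c : Fin 3 → ℝ) (a : Fin 3) : ℝ :=
  (c (a + 1) * c (a + 2) - c a) / (√(c (a + 1) ^ 2 - 1) * √(c (a + 2) ^ 2 - 1))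

/-- The angle at `a`, extended by `0` and `π` to degenerate triangles as `arccos` is constant
below `-1` and above `1`. -/
def angleOfFactor (I k : Fin 3 → ℝ) (a : Fin 3) : ℝ := Real.arccos (cosAngle (coshSide I k) a)

theorem one_lt_coshSide {I k : Fin 3 → ℝ} (hI : ∀ a, 0 < I a) (hk : ∀ a, 0 < k a) (a : Fin 3) :
    1 < coshSide I k a := by
  have h1 := Real.sinh_pos_iff.2 (hk (a + 1))
  have h2 := Real.sinh_pos_iff.2 (hk (a + 2))
  have h3 := Real.one_le_cosh (k (a + 1) - k (a + 2))
  rw [Real.cosh_sub] at h3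
  rw [coshSide, one_lt_div (mul_pos h1 h2)]
  linarith [hI a]

theorem feetInside_coth {I k : Fin 3 → ℝ} (hI : ∀ a, 0 < I a) (hk : ∀ a, 0 < k a) :
    FeetInside (coshSide I k) (fun a => Real.cosh (k a) / Real.sinh (k a)) := by
  have key : ∀ x y j : ℝ, 0 < x → 0 < y → 0 < j → Real.cosh y / Real.sinh y <
      Real.cosh x / Real.sinh x *
        ((Real.cosh x * Real.cosh y + j) / (Real.sinh x * Real.sinh y)) := by
    intro x y j hx hy hj
    have h1 := Real.sinh_pos_iff.2 hx
    have h2 := Real.sinh_pos_iff.2 hy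
    have h3 := Real.cosh_sq x
    rw [← sub_pos]
    have : Real.cosh x / Real.sinh x *
        ((Real.cosh x * Real.cosh y + j) / (Real.sinh x * Real.sinh y)) - Real.cosh y / Real.sinh y =
        (Real.cosh y + j * Real.cosh x) / (Real.sinh x ^ 2 * Real.sinh y) := by
      field_simp
      linear_combination Real.cosh y * h3
    rw [this]
    have := Real.cosh_pos x
    have := Real.cosh_pos y
    positivity
  intro a
  refine ⟨key _ _ _ (hk _) (hk _) (hI a), ?_⟩
  have := key _ _ _ (hk (a + 2)) (hk (a + 1)) (hI a)
  rwa [mul_comm (Real.cosh (k (a + 2))) (Real.cosh (k (a + 1))),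
    mul_comm (Real.sinh (k (a + 2))) (Real.sinh (k (a + 1)))] at this

theorem hasDerivAt_coshSide (I k v : Fin 3 → ℝ) (hk : ∀ a, 0 < k a) (a : Fin 3) :
    HasDerivAt (fun t : ℝ => coshSide I (k + t • v) a)
      (coshVar (coshSide I k) (fun a => Real.cosh (k a) / Real.sinh (k a)) v a) 0 := by
  have hlin : ∀ b, HasDerivAt (fun t : ℝ => (k + t • v) b) (v b) 0 := fun b => by
    simpa using ((hasDerivAt_id (0 : ℝ)).mul_const (v b)).const_add (k b)
  have h1 := Real.sinh_pos_iff.2 (hk (a + 1))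
  have h2 := Real.sinh_pos_iff.2 (hk (a + 2))
  have hne : Real.sinh ((k + (0 : ℝ) • v) (a + 1)) * Real.sinh ((k + (0 : ℝ) • v) (a + 2)) ≠ 0 := by
    simpa only [zero_smul, add_zero] using (mul_pos h1 h2).ne'
  have := (((hlin (a + 1)).cosh.mul (hlin (a + 2)).cosh).add_const (I a)).div
    ((hlin (a + 1)).sinh.mul (hlin (a + 2)).sinh) hne
  refine this.congr_deriv ?_
  simp only [coshVar, coshSide, zero_smul, add_zero, Pi.mul_apply]
  field_simp
  ring

theorem one_sub_cosAngle_sq {c : Fin 3 → ℝ} (hc : ∀ a, 1 < c a) (a : Fin 3) :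
    1 - cosAngle c a ^ 2
      = gramDet c / (√(c (a + 1) ^ 2 - 1) * √(c (a + 2) ^ 2 - 1)) ^ 2 := by
  have hp : ∀ a, 0 < c a ^ 2 - 1 := fun a => by nlinarith [hc a]
  rw [cosAngle, div_pow, mul_pow, Real.sq_sqrt (hp _).le, Real.sq_sqrt (hp _).le, gramDet_eq c a]
  have h1 := (hp (a + 1)).ne'
  have h2 := (hp (a + 2)).ne'
  field_simp

theorem one_sub_cosAngle_sq_pos {c : Fin 3 → ℝ} (hc : ∀ a, 1 < c a) (hD : 0 < gramDet c)
    (a : Fin 3) : 0 < 1 - cosAngle c a ^ 2 := by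
  have hp : ∀ a, 0 < √(c a ^ 2 - 1) := fun a => Real.sqrt_pos.2 (by nlinarith [hc a])
  rw [one_sub_cosAngle_sq hc]
  exact div_pos hD (pow_pos (mul_pos (hp _) (hp _)) 2)

theorem hasDerivAt_arccos_cosAngle {c : ℝ → Fin 3 → ℝ} {c' : Fin 3 → ℝ}
    (hc : ∀ a, HasDerivAt (fun t => c t a) (c' a) 0) (hc1 : ∀ a, 1 < c 0 a)
    (hD : 0 < gramDet (c 0)) (a : Fin 3) :
    HasDerivAt (fun t => Real.arccos (cosAngle (c t) a))
      (angleVarOfSides (c 0) c' a / √(gramDet (c 0))) 0 := by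
  have hp : ∀ a, 0 < c 0 a ^ 2 - 1 := fun a => by nlinarith [hc1 a]
  have hroot : ∀ a, HasDerivAt (fun t => √(c t a ^ 2 - 1)) (c 0 a * c' a / √(c 0 a ^ 2 - 1)) 0 := by
    intro a
    have := (((hc a).pow 2).sub_const 1).sqrt (hp a).ne'
    refine this.congr_deriv ?_
    simp
    field_simp
  have hsq : ∀ a, √(c 0 a ^ 2 - 1) ^ 2 = c 0 a ^ 2 - 1 := fun a => Real.sq_sqrt (hp a).le
  have hs : ∀ a, 0 < √(c 0 a ^ 2 - 1) := fun a => Real.sqrt_pos.2 (hp a)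
  have hlt := one_sub_cosAngle_sq_pos hc1 hD a
  have h1 : cosAngle (c 0) a ≠ -1 := fun h => by simp [h] at hlt
  have h2 : cosAngle (c 0) a ≠ 1 := fun h => by simp [h] at hlt
  have hcos : HasDerivAt (fun t => cosAngle (c t) a) _ 0 :=
    (((hc (a + 1)).mul (hc (a + 2))).sub (hc a)).div ((hroot (a + 1)).mul (hroot (a + 2)))
      (mul_pos (hs _) (hs _)).ne'
  refine ((Real.hasDerivAt_arccos h1 h2).comp 0 hcos).congr_deriv ?_
  rw [one_sub_cosAngle_sq hc1, Real.sqrt_div hD.le, Real.sqrt_sq (mul_pos (hs _) (hs _)).le]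
  have hd := Real.sqrt_pos.2 hD
  set s := √(c 0 (a + 1) ^ 2 - 1) with hsdef
  set r := √(c 0 (a + 2) ^ 2 - 1) with hrdef
  have q1 : s ^ 2 = _ := hsq (a + 1)
  have q2 : r ^ 2 = _ := hsq (a + 2)
  have hs1 : 0 < s := hs (a + 1)
  have hr1 : 0 < r := hs (a + 2)
  simp only [angleVarOfSides, Pi.mul_apply, Pi.sub_apply]
  rw [← q1, ← q2]
  field_simp
  linear_combination -(r ^ 2 * c' (a + 1) * c 0 (a + 2)) * q1
    - (s ^ 2 * c' (a + 2) * c 0 (a + 1)) * q2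

theorem angleOfFactor_of_gramDet_nonpos {I k : Fin 3 → ℝ} (hI : ∀ a, 0 < I a) (hk : ∀ a, 0 < k a)
    (hD : gramDet (coshSide I k) ≤ 0) (a : Fin 3) :
    angleOfFactor I k a = 0 ∨ angleOfFactor I k a = Real.pi := by
  have hp : ∀ a, 0 < coshSide I k a ^ 2 - 1 := fun a => by nlinarith [one_lt_coshSide hI hk a]
  have hs : ∀ a, 0 < √(coshSide I k a ^ 2 - 1) := fun a => Real.sqrt_pos.2 (hp a)
  have hpos := mul_pos (hs (a + 1)) (hs (a + 2))
  rw [gramDet_eq _ a] at hD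
  have habs : √(coshSide I k (a + 1) ^ 2 - 1) * √(coshSide I k (a + 2) ^ 2 - 1) ≤
      |coshSide I k (a + 1) * coshSide I k (a + 2) - coshSide I k a| := by
    rw [← Real.sqrt_sq hpos.le, ← Real.sqrt_sq_eq_abs]
    refine Real.sqrt_le_sqrt ?_
    rw [mul_pow, Real.sq_sqrt (hp _).le, Real.sq_sqrt (hp _).le]
    linarith
  rcases le_abs.1 habs with h | h
  · left
    exact Real.arccos_eq_zero.2 ((one_le_div hpos).2 h)
  · right
    refine Real.arccos_eq_pi.2 ?_
    rw [cosAngle, div_le_iff₀ hpos]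
    linarith


theorem contDiffAt_coshSide {I k : Fin 3 → ℝ} (hk : ∀ a, 0 < k a) (a : Fin 3) {n : WithTop ℕ∞} :
    ContDiffAt ℝ n (fun k => coshSide I k a) k := by
  have h1 := Real.sinh_pos_iff.2 (hk (a + 1))
  have h2 := Real.sinh_pos_iff.2 (hk (a + 2))
  unfold coshSide
  refine ContDiffAt.div ?_ ?_ (mul_pos h1 h2).ne' <;> fun_prop

theorem continuousOn_angleOfFactor {I : Fin 3 → ℝ} (hI : ∀ a, 0 < I a) :
    ContinuousOn (angleOfFactor I) {k | ∀ a, 0 < k a} := by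
  refine continuousOn_pi.2 fun a k hk => ContinuousAt.continuousWithinAt ?_
  have hc : ∀ a, ContinuousAt (fun k => coshSide I k a) k := fun a =>
    (contDiffAt_coshSide hk a (n := 0)).continuousAt
  have hs : ∀ a, √(coshSide I k a ^ 2 - 1) ≠ 0 := fun a =>
    (Real.sqrt_pos.2 (by nlinarith [one_lt_coshSide hI hk a])).ne'
  refine Real.continuous_arccos.continuousAt.comp (ContinuousAt.div
    (((hc _).mul (hc _)).sub (hc _)) ?_ (mul_ne_zero (hs _) (hs _)))
  exact ((((hc _).pow 2).sub continuousAt_const).sqrt).mul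
    ((((hc _).pow 2).sub continuousAt_const).sqrt)

theorem contDiffAt_angleOfFactor {I k : Fin 3 → ℝ} (hI : ∀ a, 0 < I a) (hk : ∀ a, 0 < k a)
    (hD : 0 < gramDet (coshSide I k)) {n : WithTop ℕ∞} : ContDiffAt ℝ n (angleOfFactor I) k := by
  refine contDiffAt_pi.2 fun a => ?_
  have hc : ∀ a, ContDiffAt ℝ n (fun k => coshSide I k a) k := fun a => contDiffAt_coshSide hk a
  have hp : ∀ a, 0 < coshSide I k a ^ 2 - 1 := fun a => by nlinarith [one_lt_coshSide hI hk a]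
  have hs : ∀ a, √(coshSide I k a ^ 2 - 1) ≠ 0 := fun a => (Real.sqrt_pos.2 (hp a)).ne'
  have hlt := one_sub_cosAngle_sq_pos (one_lt_coshSide hI hk) hD a
  refine (Real.contDiffAt_arccos (fun h => by simp [h] at hlt) (fun h => by simp [h] at hlt)).comp k
    (ContDiffAt.div (((hc _).mul (hc _)).sub (hc _)) ?_ (mul_ne_zero (hs _) (hs _)))
  exact ((((hc _).pow 2).sub contDiffAt_const).sqrt (hp _).ne').mul
    ((((hc _).pow 2).sub contDiffAt_const).sqrt (hp _).ne')

theorem fderiv_angleOfFactor {I k : Fin 3 → ℝ} (hI : ∀ a, 0 < I a) (hk : ∀ a, 0 < k a)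
    (hD : 0 < gramDet (coshSide I k)) (v : Fin 3 → ℝ) :
    fderiv ℝ (angleOfFactor I) k v = (√(gramDet (coshSide I k)))⁻¹ •
      angleVar (coshSide I k) (fun a => Real.cosh (k a) / Real.sinh (k a)) v := by
  have hd : DifferentiableAt ℝ (angleOfFactor I) k :=
    (contDiffAt_angleOfFactor hI hk hD (n := 1)).differentiableAt (by simp)
  have hline : HasDerivAt (fun t : ℝ => k + t • v) v 0 := by
    simpa using ((hasDerivAt_id (0 : ℝ)).smul_const v).const_add k
  have h1 : HasDerivAt (fun t : ℝ => angleOfFactor I (k + t • v))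
      (fderiv ℝ (angleOfFactor I) k v) 0 := by
    have h0 : HasFDerivAt (angleOfFactor I) (fderiv ℝ (angleOfFactor I) k) (k + (0 : ℝ) • v) := by
      simpa using hd.hasFDerivAt
    exact h0.comp_hasDerivAt (0 : ℝ) hline
  funext a
  have h2 := hasDerivAt_pi.1 h1 a
  have h3 := hasDerivAt_arccos_cosAngle (c := fun t => coshSide I (k + t • v))
    (fun a => hasDerivAt_coshSide I k v hk a) (by simpa using one_lt_coshSide hI hk)
    (by simpa using hD) a
  have := h2.unique h3
  simp only [zero_smul, add_zero] at this
  rw [this, Pi.smul_apply, smul_eq_mul, angleVar_apply, div_eq_inv_mul]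

theorem fderiv_angleOfFactor_symm {I k : Fin 3 → ℝ} (hI : ∀ a, 0 < I a) (hk : ∀ a, 0 < k a)
    (hD : 0 < gramDet (coshSide I k)) (v w : Fin 3 → ℝ) :
    v ⬝ᵥ fderiv ℝ (angleOfFactor I) k w = w ⬝ᵥ fderiv ℝ (angleOfFactor I) k v := by
  rw [fderiv_angleOfFactor hI hk hD, fderiv_angleOfFactor hI hk hD, dotProduct_smul,
    dotProduct_smul, angleVar_symm (one_lt_coshSide hI hk)]

theorem fderiv_angleOfFactor_pos {I k : Fin 3 → ℝ} (hI : ∀ a, 0 < I a) (hk : ∀ a, 0 < k a)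
    (hD : 0 < gramDet (coshSide I k)) {v : Fin 3 → ℝ} (hv : v ≠ 0) :
    0 < v ⬝ᵥ fderiv ℝ (angleOfFactor I) k v := by
  rw [fderiv_angleOfFactor hI hk hD, dotProduct_smul]
  exact mul_pos (inv_pos.2 (Real.sqrt_pos.2 hD))
    (angleVar_pos (one_lt_coshSide hI hk) hD (feetInside_coth hI hk) hv)

theorem monotoneOn_dotProduct_angleOfFactor {I k v : Fin 3 → ℝ} (hI : ∀ a, 0 < I a)
    (hk : ∀ a, 0 < k a) (hkv : ∀ a, 0 < (k + v) a) :
    MonotoneOn (fun t : ℝ => v ⬝ᵥ angleOfFactor I (k + t • v)) (Icc 0 1) := by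
  have hpos : ∀ t ∈ Icc (0 : ℝ) 1, ∀ a, 0 < (k + t • v) a := by
    intro t ht a
    have h1 := hk a
    have h2 := hkv a
    simp only [Pi.add_apply, Pi.smul_apply, smul_eq_mul] at h2 ⊢
    nlinarith [mul_nonneg ht.1 h2.le, mul_nonneg (sub_nonneg.2 ht.2) h1.le, ht.1, ht.2]
  have hcont : ContinuousOn (fun t : ℝ => angleOfFactor I (k + t • v)) (Icc 0 1) :=
    (continuousOn_angleOfFactor hI).comp (by fun_prop) hpos
  have hfin : (range fun e : Fin 3 → Bool =>
      v ⬝ᵥ fun a => if e a then Real.pi else 0).Finite := finite_range _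
  refine monotoneOn_of_deriv_nonneg_of_finite (O := {t | 0 < gramDet (coshSide I (k + t • v))})
    ?_ hfin (fun t ht hD => ?_) fun t ht hD => ?_
  · simp only [dotProduct]
    exact continuousOn_finsetSum _ fun a _ => continuousOn_const.mul (continuousOn_pi.1 hcont a)
  · have hd : DifferentiableAt ℝ (angleOfFactor I) (k + t • v) :=
      (contDiffAt_angleOfFactor hI (hpos t ht) hD (n := 1)).differentiableAt (by simp)
    have hline : HasDerivAt (fun t : ℝ => k + t • v) v t := by
      simpa using ((hasDerivAt_id t).smul_const v).const_add k
    have h1 := hasDerivAt_pi.1 (hd.hasFDerivAt.comp_hasDerivAt t hline)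
    refine ⟨v ⬝ᵥ fderiv ℝ (angleOfFactor I) (k + t • v) v, ?_, ?_⟩
    · simp only [dotProduct]
      exact HasDerivAt.fun_sum fun a _ => (h1 a).const_mul (v a)
    · by_cases hv : v = 0
      · simp [hv]
      · exact (fderiv_angleOfFactor_pos hI (hpos t ht) hD hv).le
  · have h1 := fun a => angleOfFactor_of_gramDet_nonpos hI (hpos t ht) (not_lt.1 hD) a
    refine ⟨fun a => decide (angleOfFactor I (k + t • v) a = Real.pi), ?_⟩
    simp only [decide_eq_true_eq]
    congr 1
    funext a
    split_ifs with h
    · exact h.symm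
    · exact ((h1 a).resolve_right h).symm

end HyperbolicTriangle

/-! ### The angle defects of a decorated metric -/

namespace DecoratedPHMetric

open HyperbolicTriangle

variable {V E F : Type*} {T : SurfaceTriangulation V E F} (M : DecoratedPHMetric T)

theorem inversiveDistance_pos (f : F) (a : Fin 3) : 0 < M.inversiveDistance f a := by
  have h1 := M.r_pos (T.vert f (a + 1))
  have h2 := M.r_pos (T.vert f (a + 2))
  have h3 := Real.cosh_lt_cosh.2 (show |M.r (T.vert f (a + 1)) + M.r (T.vert f (a + 2))| <
    |M.l (T.edge f a)| by
      rw [abs_of_pos (add_pos h1 h2), abs_of_pos (M.l_pos _)]; exact M.separated f a)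
  rw [Real.cosh_add] at h3
  have h4 := mul_pos (Real.sinh_pos_iff.2 h1) (Real.sinh_pos_iff.2 h2)
  exact div_pos (by linarith) h4

theorem exp_neg_mem_Ioo {x : ℝ} (hx : 0 < x) : Real.exp (-x) ∈ Ioo (-1 : ℝ) 1 :=
  ⟨by linarith [Real.exp_pos (-x)], Real.exp_lt_one_iff.2 (by linarith)⟩

theorem one_sub_exp_neg_sq_pos {x : ℝ} (hx : 0 < x) : 0 < 1 - Real.exp (-x) ^ 2 := by
  have h := exp_neg_mem_Ioo hx
  nlinarith [h.1, h.2]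

theorem cosh_radius {h : V → ℝ} {i : V} (hi : 0 < h i) :
    Real.cosh (radius h i) = Real.cosh (h i) / Real.sinh (h i) := by
  have hp := one_sub_exp_neg_sq_pos hi
  have he := Real.exp_pos (h i)
  have hs := Real.sinh_pos_iff.2 hi
  rw [radius, Real.cosh_two_mul, Real.sinh_artanh (exp_neg_mem_Ioo hi),
    Real.cosh_artanh (exp_neg_mem_Ioo hi), div_pow, div_pow, Real.sq_sqrt hp.le, one_pow,
    ← add_div, div_eq_div_iff hp.ne' hs.ne', Real.cosh_eq, Real.sinh_eq, Real.exp_neg]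
  field_simp

theorem sinh_radius {h : V → ℝ} {i : V} (hi : 0 < h i) :
    Real.sinh (radius h i) = 1 / Real.sinh (h i) := by
  have hp := one_sub_exp_neg_sq_pos hi
  have he := Real.exp_pos (h i)
  have hs := Real.sinh_pos_iff.2 hi
  rw [radius, Real.sinh_two_mul, Real.sinh_artanh (exp_neg_mem_Ioo hi),
    Real.cosh_artanh (exp_neg_mem_Ioo hi), mul_assoc, div_mul_div_comm, ← sq, Real.sq_sqrt hp.le,
    mul_one, ← mul_div_assoc, div_eq_div_iff hp.ne' hs.ne', Real.sinh_eq, Real.exp_neg]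
  field_simp

theorem sideLength_eq {h : V → ℝ} (hh : ∀ i, 0 < h i) (f : F) (a : Fin 3) :
    M.sideLength h f a =
      Real.arcosh (coshSide (M.inversiveDistance f) (fun a => h (T.vert f a)) a) := by
  have h1 := Real.sinh_pos_iff.2 (hh (T.vert f (a + 1)))
  have h2 := Real.sinh_pos_iff.2 (hh (T.vert f (a + 2)))
  rw [sideLength, cosh_radius (hh _), cosh_radius (hh _), sinh_radius (hh _), sinh_radius (hh _),
    coshSide]
  congr 1
  field_simp

theorem angle_eq {h : V → ℝ} (hh : ∀ i, 0 < h i) (f : F) (a : Fin 3) :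
    M.angle h f a = angleOfFactor (M.inversiveDistance f) (fun a => h (T.vert f a)) a := by
  have hc := fun a => (one_lt_coshSide (M.inversiveDistance_pos f) (fun a => hh (T.vert f a)) a).le
  simp only [angle, M.sideLength_eq hh, Real.cosh_arcosh (hc _), Real.sinh_arcosh (hc _)]
  rfl

theorem gramDet_pos {h : V → ℝ} (hh : h ∈ M.admissible) (f : F) :
    0 < gramDet (coshSide (M.inversiveDistance f) (fun a => h (T.vert f a))) := by
  obtain ⟨hpos, htri⟩ := hh
  have hc := fun a => (one_lt_coshSide (M.inversiveDistance_pos f) (fun a => hpos (T.vert f a)) a)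
  have hl : ∀ a, Real.cosh (M.sideLength h f a) =
      coshSide (M.inversiveDistance f) (fun a => h (T.vert f a)) a := fun a => by
    rw [M.sideLength_eq hpos, Real.cosh_arcosh (hc a).le]
  have hl0 : ∀ a, 0 < M.sideLength h f a := fun a => by
    rw [M.sideLength_eq hpos]; exact Real.arcosh_pos (hc a)
  have t0 := htri f 0
  have t1 := htri f 1
  have t2 := htri f 2
  simp at t0 t1 t2
  have key1 := Real.cosh_lt_cosh.2 (show |M.sideLength h f 0| <
      |M.sideLength h f 1 + M.sideLength h f 2| by
    rw [abs_of_pos (hl0 0), abs_of_pos (add_pos (hl0 1) (hl0 2))]; exact t0)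
  have key2 := Real.cosh_lt_cosh.2 (show |M.sideLength h f 1 - M.sideLength h f 2| <
      |M.sideLength h f 0| by
    rw [abs_of_pos (hl0 0), abs_lt]; constructor <;> linarith)
  rw [Real.cosh_add] at key1
  rw [Real.cosh_sub] at key2
  rw [gramDet_eq _ 0]
  simp only [← hl, zero_add]
  rw [Real.cosh_sq, Real.cosh_sq]
  nlinarith [mul_pos (sub_pos.2 key1) (sub_pos.2 key2)]

theorem continuousOn_sideLength [Fintype V] (f : F) (a : Fin 3) :
    ContinuousOn (fun h => M.sideLength h f a) {h | ∀ i, 0 < h i} := by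
  intro h hh
  have hk := fun a => hh (T.vert f a)
  have h1 : ContinuousAt (fun h : V → ℝ =>
      Real.arcosh (coshSide (M.inversiveDistance f) (fun a => h (T.vert f a)) a)) h := by
    have h2 : ContinuousAt (fun h : V → ℝ =>
        coshSide (M.inversiveDistance f) (fun a => h (T.vert f a)) a) h :=
      ContinuousAt.comp (g := fun k => coshSide (M.inversiveDistance f) k a)
        (f := fun (h : V → ℝ) a => h (T.vert f a))
        (contDiffAt_coshSide hk a (n := 0)).continuousAt
        (continuous_pi fun a => continuous_apply _).continuousAt
    exact ContinuousAt.comp (g := Real.arcosh) (Real.contDiffAt_arcosh (n := 0)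
      (one_lt_coshSide (M.inversiveDistance_pos f) hk a)).continuousAt h2
  exact h1.continuousWithinAt.congr (fun g hg => M.sideLength_eq hg f a) (M.sideLength_eq hh f a)

theorem isOpen_admissible [Fintype V] [Fintype F] : IsOpen M.admissible := by
  have : M.admissible = {h | ∀ i, 0 < h i} ∩ ⋂ f : F, ⋂ a : Fin 3,
      ({h | ∀ i, 0 < h i} ∩ (fun h => M.sideLength h f (a + 1) + M.sideLength h f (a + 2)
        - M.sideLength h f a) ⁻¹' Ioi 0) := by
    ext h
    simp only [admissible, mem_ofPred_eq, mem_inter_iff, mem_iInter, mem_preimage, mem_Ioi, sub_pos]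
    grind
  rw [this]
  refine isOpen_forall_pos.inter
    (isOpen_iInter_of_finite fun f => isOpen_iInter_of_finite fun a => ?_)
  exact (((M.continuousOn_sideLength f _).add (M.continuousOn_sideLength f _)).sub
    (M.continuousOn_sideLength f _)).isOpen_inter_preimage isOpen_forall_pos isOpen_Ioi

variable [Fintype F]

theorem contDiffAt_angleDefect [Fintype V] {h : V → ℝ} (hh : h ∈ M.admissible) {n : WithTop ℕ∞} :
    ContDiffAt ℝ n M.angleDefect h := by
  classical
  refine contDiffAt_pi.2 fun i => ?_
  have hang : ∀ f a, ContDiffAt ℝ n (fun h => M.angle h f a) h := by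
    intro f a
    have h1 : ContDiffAt ℝ n (fun h : V → ℝ =>
        angleOfFactor (M.inversiveDistance f) (fun a => h (T.vert f a)) a) h := by
      exact ContDiffAt.comp h (g := fun k => angleOfFactor (M.inversiveDistance f) k a)
        (f := fun (h : V → ℝ) a => h (T.vert f a))
        (contDiffAt_pi.1 (contDiffAt_angleOfFactor (M.inversiveDistance_pos f)
          (fun a => hh.1 (T.vert f a)) (M.gramDet_pos hh f)) a) (by fun_prop)
    refine h1.congr_of_eventuallyEq ?_
    filter_upwards [isOpen_forall_pos.mem_nhds hh.1] with g hg using M.angle_eq hg f a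
  unfold angleDefect
  refine contDiffAt_const.sub (ContDiffAt.sum fun f _ => ContDiffAt.sum fun a _ => ?_)
  split_ifs
  · exact hang f a
  · exact contDiffAt_const

variable [Fintype V]

/-- Summation over the vertices turned into a sum over the faces. A face may have several corners
at the same vertex; then the pullback of `v` to the face has repeated entries. -/
theorem dotProduct_angleDefect (v : V → ℝ) {h : V → ℝ} (hh : ∀ i, 0 < h i) :
    v ⬝ᵥ M.angleDefect h = 2 * Real.pi * ∑ i, v i -
      ∑ f, (fun a => v (T.vert f a)) ⬝ᵥ
        angleOfFactor (M.inversiveDistance f) (fun a => h (T.vert f a)) := by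
  classical
  simp only [dotProduct, angleDefect, mul_sub, Finset.sum_sub_distrib, Finset.mul_sum]
  congr 1
  · exact Finset.sum_congr rfl fun i _ => mul_comm _ _
  · rw [Finset.sum_comm]
    refine Finset.sum_congr rfl fun f _ => ?_
    rw [Finset.sum_comm]
    refine Finset.sum_congr rfl fun a _ => ?_
    simp [M.angle_eq hh]

theorem dotProduct_fderiv_angleDefect {h : V → ℝ} (hh : h ∈ M.admissible) (v w : V → ℝ) :
    v ⬝ᵥ fderiv ℝ M.angleDefect h w = -∑ f, (fun a => v (T.vert f a)) ⬝ᵥ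
      fderiv ℝ (angleOfFactor (M.inversiveDistance f)) (fun a => h (T.vert f a))
        (fun a => w (T.vert f a)) := by
  have hline : HasDerivAt (fun t : ℝ => h + t • w) w 0 := by
    simpa using ((hasDerivAt_id (0 : ℝ)).smul_const w).const_add h
  have h0 : HasFDerivAt M.angleDefect (fderiv ℝ M.angleDefect h) (h + (0 : ℝ) • w) := by
    simpa using ((M.contDiffAt_angleDefect hh (n := 1)).differentiableAt (by simp)).hasFDerivAt
  have h1 := hasDerivAt_pi.1 (h0.comp_hasDerivAt (0 : ℝ) hline)
  have h2 : HasDerivAt (fun t : ℝ => v ⬝ᵥ M.angleDefect (h + t • w))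
      (v ⬝ᵥ fderiv ℝ M.angleDefect h w) 0 := by
    simp only [dotProduct]
    exact HasDerivAt.fun_sum fun i _ => (h1 i).const_mul (v i)
  have h3 : HasDerivAt (fun t : ℝ => 2 * Real.pi * ∑ i, v i - ∑ f, (fun a => v (T.vert f a)) ⬝ᵥ
        angleOfFactor (M.inversiveDistance f) (fun a => (h + t • w) (T.vert f a)))
      (-∑ f, (fun a => v (T.vert f a)) ⬝ᵥ
      fderiv ℝ (angleOfFactor (M.inversiveDistance f)) (fun a => h (T.vert f a))
        (fun a => w (T.vert f a))) 0 := by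
    refine HasDerivAt.const_sub _ (HasDerivAt.fun_sum fun f _ => ?_)
    have hline' : HasDerivAt (fun (t : ℝ) a => (h + t • w) (T.vert f a))
        (fun a => w (T.vert f a)) 0 := hasDerivAt_pi.2 fun a => hasDerivAt_pi.1 hline _
    have h4 : HasFDerivAt (angleOfFactor (M.inversiveDistance f))
        (fderiv ℝ (angleOfFactor (M.inversiveDistance f)) (fun a => h (T.vert f a)))
        (fun a => (h + (0 : ℝ) • w) (T.vert f a)) := by
      simpa using ((contDiffAt_angleOfFactor (M.inversiveDistance_pos f)
        (fun a => hh.1 (T.vert f a)) (M.gramDet_pos hh f) (n := 1)).differentiableAt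
        (by simp)).hasFDerivAt
    have h5 := hasDerivAt_pi.1 (h4.comp_hasDerivAt (0 : ℝ) hline')
    simp only [dotProduct]
    exact HasDerivAt.fun_sum fun a _ => (h5 a).const_mul (v (T.vert f a))
  refine h2.unique (h3.congr_of_eventuallyEq ?_)
  have hev : ∀ᶠ t : ℝ in 𝓝 0, h + t • w ∈ {k : V → ℝ | ∀ i, 0 < k i} :=
    hline.continuousAt.eventually_mem (isOpen_forall_pos.mem_nhds (by simpa using hh.1))
  filter_upwards [hev] with t ht using M.dotProduct_angleDefect v ht

theorem fderiv_angleDefect_symm {h : V → ℝ} (hh : h ∈ M.admissible) (v w : V → ℝ) :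
    v ⬝ᵥ fderiv ℝ M.angleDefect h w = w ⬝ᵥ fderiv ℝ M.angleDefect h v := by
  rw [M.dotProduct_fderiv_angleDefect hh, M.dotProduct_fderiv_angleDefect hh]
  refine congrArg Neg.neg (Finset.sum_congr rfl fun f _ => ?_)
  exact fderiv_angleOfFactor_symm (M.inversiveDistance_pos f) (fun a => hh.1 (T.vert f a))
    (M.gramDet_pos hh f) _ _

theorem fderiv_angleDefect_neg {h : V → ℝ} (hh : h ∈ M.admissible) {v : V → ℝ} (hv : v ≠ 0) :
    v ⬝ᵥ fderiv ℝ M.angleDefect h v < 0 := by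
  rw [M.dotProduct_fderiv_angleDefect hh, neg_lt_zero]
  have hp := fun f {w : Fin 3 → ℝ} (hw : w ≠ 0) => fderiv_angleOfFactor_pos
    (M.inversiveDistance_pos f) (fun a => hh.1 (T.vert f a)) (M.gramDet_pos hh f) hw
  obtain ⟨i, hi⟩ := Function.ne_iff.1 hv
  obtain ⟨f, a, rfl⟩ := T.vert_surjective i
  refine Finset.sum_pos' (fun f _ => ?_) ⟨f, Finset.mem_univ f, hp f (Function.ne_iff.2 ⟨a, hi⟩)⟩
  by_cases h0 : (fun a => v (T.vert f a)) = 0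
  · simp [h0]
  · exact (hp f h0).le

/-- The segment need not stay in the admissible space. -/
theorem antitoneOn_dotProduct_angleDefect {h v : V → ℝ} (hh : ∀ i, 0 < h i)
    (hv : ∀ i, 0 < (h + v) i) :
    AntitoneOn (fun t : ℝ => v ⬝ᵥ M.angleDefect (h + t • v)) (Icc 0 1) := by
  have hpos : ∀ t ∈ Icc (0 : ℝ) 1, ∀ a, 0 < (h + t • v) a := by
    intro t ht a
    have h1 := hh a
    have h2 := hv a
    simp only [Pi.add_apply, Pi.smul_apply, smul_eq_mul] at h2 ⊢
    nlinarith [mul_nonneg ht.1 h2.le, mul_nonneg (sub_nonneg.2 ht.2) h1.le, ht.1, ht.2]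
  intro s hs t ht hst
  simp only [M.dotProduct_angleDefect v (hpos s hs), M.dotProduct_angleDefect v (hpos t ht)]
  refine sub_le_sub_left (Finset.sum_le_sum fun f _ => ?_) _
  exact monotoneOn_dotProduct_angleOfFactor (M.inversiveDistance_pos f)
    (k := fun a => h (T.vert f a)) (v := fun a => v (T.vert f a)) (fun a => hh _) (fun a => hv _)
    hs ht hst

theorem dotProduct_angleDefect_sub_neg {h v : V → ℝ} (hv : v ≠ 0)
    (hh : ∀ t ∈ Icc (0 : ℝ) 1, h + t • v ∈ M.admissible) :
    v ⬝ᵥ (M.angleDefect (h + v) - M.angleDefect h) < 0 := by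
  have hd : ∀ t ∈ Icc (0 : ℝ) 1, HasDerivAt (fun t : ℝ => v ⬝ᵥ M.angleDefect (h + t • v))
      (v ⬝ᵥ fderiv ℝ M.angleDefect (h + t • v) v) t := by
    intro t ht
    have hline : HasDerivAt (fun t : ℝ => h + t • v) v t := by
      simpa using ((hasDerivAt_id t).smul_const v).const_add h
    have h1 := hasDerivAt_pi.1 (((M.contDiffAt_angleDefect (hh t ht)
      (n := 1)).differentiableAt (by simp)).hasFDerivAt.comp_hasDerivAt t hline)
    simp only [dotProduct]
    exact HasDerivAt.fun_sum fun i _ => (h1 i).const_mul (v i)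
  have hanti : StrictAntiOn (fun t : ℝ => v ⬝ᵥ M.angleDefect (h + t • v)) (Icc 0 1) := by
    refine strictAntiOn_of_deriv_neg (convex_Icc 0 1)
      (fun t ht => (hd t ht).continuousAt.continuousWithinAt) fun t ht => ?_
    have ht' := interior_subset ht
    rw [(hd t ht').deriv]
    exact M.fderiv_angleDefect_neg (hh t ht') hv
  have := hanti (left_mem_Icc.2 zero_le_one) (right_mem_Icc.2 zero_le_one) zero_lt_one
  simp only [one_smul, zero_smul, add_zero] at this
  rw [dotProduct_sub]
  linarith

/-- The gap is strict on a small sphere around `hbar` by compactness, and it grows at least linearly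
along rays by monotonicity. -/
theorem exists_dotProduct_angleDefect_sub_le {hbar : V → ℝ} (hbar_mem : hbar ∈ M.admissible)
    {N : Set (V → ℝ)} (hN : N ∈ 𝓝 hbar) :
    ∃ m > 0, ∀ h : V → ℝ, (∀ i, 0 < h i) → h ∉ N →
      (h - hbar) ⬝ᵥ (M.angleDefect h - M.angleDefect hbar) ≤ -(m * ‖h - hbar‖) := by
  obtain ⟨e, he, hsub⟩ := Metric.nhds_basis_closedBall.mem_iff.1
    (inter_mem hN (M.isOpen_admissible.mem_nhds hbar_mem))
  have : Nonempty V := by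
    obtain ⟨f⟩ := T.nonempty
    exact ⟨T.vert f 0⟩
  have hmem : ∀ u : V → ℝ, ‖u‖ ≤ e → hbar + u ∈ M.admissible := fun u hu =>
    (hsub (show hbar + u ∈ Metric.closedBall hbar e by simpa using hu)).2
  have hcont : ContinuousOn (fun u => u ⬝ᵥ (M.angleDefect (hbar + u) - M.angleDefect hbar))
      (Metric.sphere (0 : V → ℝ) e) := by
    intro u hu
    have hu' : ‖u‖ ≤ e := by simpa using (mem_sphere_iff_norm.1 hu).le
    have h1 : ContinuousAt (fun u => M.angleDefect (hbar + u)) u :=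
      ContinuousAt.comp (f := fun u => hbar + u) (M.contDiffAt_angleDefect (hmem u hu')
        (n := 0)).continuousAt (by fun_prop)
    refine ContinuousAt.continuousWithinAt ?_
    simp only [dotProduct]
    exact tendsto_finsetSum _ fun i _ => (continuous_apply i).continuousAt.mul
      (((continuous_apply i).continuousAt.comp h1).sub continuousAt_const)
  obtain ⟨u₀, hu₀, hmax⟩ := (isCompact_sphere (0 : V → ℝ) e).exists_isMaxOn
    (NormedSpace.sphere_nonempty.2 he.le) hcont
  have hn₀ : ‖u₀‖ = e := by simpa using hu₀
  have hneg : u₀ ⬝ᵥ (M.angleDefect (hbar + u₀) - M.angleDefect hbar) < 0 := by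
    refine M.dotProduct_angleDefect_sub_neg (norm_ne_zero_iff.1 (by rw [hn₀]; exact he.ne'))
      fun t ht => hmem _ ?_
    rw [norm_smul, hn₀, Real.norm_of_nonneg ht.1]
    nlinarith [ht.1, ht.2]
  set m₀ := u₀ ⬝ᵥ (M.angleDefect (hbar + u₀) - M.angleDefect hbar) with hm₀
  refine ⟨-m₀ / e, div_pos (neg_pos.2 hneg) he, fun h hpos hhN => ?_⟩
  set v := h - hbar with hv
  have hve : e < ‖v‖ := by
    by_contra! hle
    exact hhN (hsub (show h ∈ Metric.closedBall hbar e by simpa [dist_eq_norm] using hle)).1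
  have hv0 : 0 < ‖v‖ := he.trans hve
  have hhv : h = hbar + v := by simp [hv]
  have hanti := M.antitoneOn_dotProduct_angleDefect (v := v) hbar_mem.1 (by rw [← hhv]; exact hpos)
  set s := e / ‖v‖ with hs
  have hs0 : 0 < s := div_pos he hv0
  have hs1 : s ≤ 1 := (div_le_one hv0).2 hve.le
  have h1 := hanti ⟨hs0.le, hs1⟩ (right_mem_Icc.2 zero_le_one) hs1
  simp only [one_smul, ← hhv] at h1
  have h2 : _ ≤ m₀ := hmax (show s • v ∈ Metric.sphere (0 : V → ℝ) e by
    rw [mem_sphere_zero_iff_norm, norm_smul, Real.norm_of_nonneg hs0.le, hs,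
      div_mul_cancel₀ _ hv0.ne'])
  simp only [smul_dotProduct, smul_eq_mul] at h2
  rw [dotProduct_sub] at h2 ⊢
  have h3 : v ⬝ᵥ M.angleDefect (hbar + s • v) - v ⬝ᵥ M.angleDefect hbar ≤ m₀ / s := by
    rw [le_div_iff₀ hs0]; linarith
  have h4 : m₀ / s = -(-m₀ / e * ‖v‖) := by
    rw [hs]; field_simp
  linarith

end DecoratedPHMetric

/-! ### Exponential stability of zeros of vector fields -/

/-- A bounded Lipschitz vector field has global integral curves: as the field is bounded, the
Picard-Lindelöf theorem applies on every interval `[-n - 1, n + 1]`. -/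
theorem exists_global_solution_of_bounded {E : Type*} [NormedAddCommGroup E] [NormedSpace ℝ E]
    [CompleteSpace E] {X : E → E} {K B : NNReal} (hX : LipschitzWith K X) (hB : ∀ x, ‖X x‖ ≤ B)
    (x₀ : E) : ∃ h : ℝ → E, h 0 = x₀ ∧ ∀ t, HasDerivAt h (X (h t)) t := by
  have hloc : ∀ n : ℕ, ∃ α : ℝ → E, α 0 = x₀ ∧
      ∀ t ∈ Ioo (-(n + 1 : ℝ)) (n + 1), HasDerivAt α (X (α t)) t := by
    intro n
    have hn : (0 : ℝ) ≤ n := Nat.cast_nonneg n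
    have hPL : IsPicardLindelof (fun _ : ℝ => X) (tmin := -(n + 1 : ℝ)) (tmax := n + 1)
        ⟨0, by constructor <;> linarith⟩ x₀ (B * (n + 1)) 0 B K :=
      { lipschitzOnWith := fun _ _ => hX.lipschitzOnWith
        continuousOn := fun _ _ => continuousOn_const
        norm_le := fun _ _ x _ => hB x
        mul_max_le := by simp }
    obtain ⟨α, h1, h2⟩ := hPL.exists_eq_forall_mem_Icc_hasDerivWithinAt₀
    exact ⟨α, h1, fun t ht => (h2 t (Ioo_subset_Icc_self ht)).hasDerivAt (Icc_mem_nhds ht.1 ht.2)⟩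
  choose α hα0 hα using hloc
  have hagree : ∀ m n : ℕ, ∀ t : ℝ, |t| < m + 1 → |t| < n + 1 → α m t = α n t := by
    intro m n t hm hn
    have hsub : ∀ k : ℕ, min (m : ℝ) n ≤ k →
        Ioo (-(min (m : ℝ) n + 1)) (min (m : ℝ) n + 1) ⊆ Ioo (-(k + 1 : ℝ)) (k + 1) := fun k hk =>
      Ioo_subset_Ioo (by linarith) (by linarith)
    have hmin : 0 ≤ min (m : ℝ) n := by positivity
    refine ODE_solution_unique_of_mem_Ioo (v := fun _ => X) (s := fun _ => univ) (K := K)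
      (t₀ := 0) (a := -(min (m : ℝ) n + 1)) (b := min (m : ℝ) n + 1)
      (fun _ _ => hX.lipschitzOnWith) ⟨by linarith, by linarith⟩
      (fun s hs => ⟨hα m s (hsub m (min_le_left _ _) hs), mem_univ _⟩)
      (fun s hs => ⟨hα n s (hsub n (min_le_right _ _) hs), mem_univ _⟩)
      ((hα0 m).trans (hα0 n).symm) ?_
    rw [mem_Ioo, ← abs_lt]
    rcases min_choice (m : ℝ) n with h | h <;> rwa [h]
  refine ⟨fun t => α ⌈|t|⌉₊ t, by simp [hα0], fun t => ?_⟩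
  have ht : |t| < (⌈|t|⌉₊ : ℝ) + 1 := (Nat.le_ceil _).trans_lt (lt_add_one _)
  refine (hα _ t (abs_lt.1 ht)).congr_of_eventuallyEq ?_
  filter_upwards [continuous_abs.continuousAt.eventually_lt continuousAt_const ht] with s hs
  exact hagree _ _ s ((Nat.le_ceil _).trans_lt (lt_add_one _)) hs

theorem exists_forall_mul_norm_sq_le {ι : Type*} [Fintype ι] (A : (ι → ℝ) →ₗ[ℝ] (ι → ℝ))
    (hA : ∀ v, v ≠ 0 → 0 < v ⬝ᵥ A v) : ∃ c > 0, ∀ v, c * ‖v‖ ^ 2 ≤ v ⬝ᵥ A v := by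
  rcases isEmpty_or_nonempty ι with hι | hι
  · exact ⟨1, one_pos, fun v => by simp [Subsingleton.elim v 0]⟩
  have hAc : Continuous A := LinearMap.continuous_of_finiteDimensional A
  have hne : ∀ v ∈ Metric.sphere (0 : ι → ℝ) 1, v ≠ 0 := fun v hv => by
    rintro rfl; simp at hv
  obtain ⟨u, hu, hmin⟩ := (isCompact_sphere (0 : ι → ℝ) 1).exists_isMinOn
    (f := fun v => v ⬝ᵥ A v) (NormedSpace.sphere_nonempty.2 zero_le_one) (by fun_prop)
  refine ⟨u ⬝ᵥ A u, hA u (hne u hu), fun v => ?_⟩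
  by_cases hv : v = 0
  · simp [hv]
  have hn := norm_pos_iff.2 hv
  have h1 : u ⬝ᵥ A u ≤ _ := hmin (show ‖v‖⁻¹ • v ∈ Metric.sphere (0 : ι → ℝ) 1 by
    simp [norm_smul, hn.ne'])
  simp only [map_smul, smul_dotProduct, dotProduct_smul, smul_eq_mul] at h1
  calc u ⬝ᵥ A u * ‖v‖ ^ 2 ≤ ‖v‖⁻¹ * (‖v‖⁻¹ * (v ⬝ᵥ A v)) * ‖v‖ ^ 2 := by gcongr
    _ = v ⬝ᵥ A v := by field_simp

theorem abs_dotProduct_le_card_mul {ι : Type*} [Fintype ι] (v w : ι → ℝ) :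
    |v ⬝ᵥ w| ≤ Fintype.card ι * (‖v‖ * ‖w‖) := by
  refine (Finset.abs_sum_le_sum_abs _ _).trans ?_
  refine (Finset.sum_le_card_nsmul _ _ (‖v‖ * ‖w‖) fun i _ => ?_).trans (by simp)
  rw [abs_mul]
  exact mul_le_mul (norm_le_pi_norm v i) (norm_le_pi_norm w i) (abs_nonneg _) (norm_nonneg _)

/-- The coordinatewise retraction of `ι → ℝ` onto the closed ball of radius `ρ` around `x₀` for the
sup norm. -/
def boxClamp {ι : Type*} (x₀ : ι → ℝ) (ρ : ℝ) (y : ι → ℝ) (i : ι) : ℝ :=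
  max (x₀ i - ρ) (min (x₀ i + ρ) (y i))

theorem lipschitzWith_boxClamp {ι : Type*} [Fintype ι] (x₀ : ι → ℝ) (ρ : ℝ) :
    LipschitzWith 1 (boxClamp x₀ ρ) := by
  refine LipschitzWith.of_dist_le_mul fun y z => ?_
  rw [NNReal.coe_one, one_mul]
  refine (dist_pi_le_iff dist_nonneg).2 fun i => le_trans ?_ (dist_le_pi_dist y z i)
  simp only [boxClamp, Real.dist_eq]
  refine (abs_max_sub_max_le_max _ _ _ _).trans (max_le (by simp) ?_)
  exact (abs_min_sub_min_le_max _ _ _ _).trans (max_le (by simp) le_rfl)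

theorem boxClamp_mem {ι : Type*} [Fintype ι] (x₀ : ι → ℝ) {ρ : ℝ} (hρ : 0 ≤ ρ) (y : ι → ℝ) :
    boxClamp x₀ ρ y ∈ Metric.closedBall x₀ ρ := by
  refine (dist_pi_le_iff hρ).2 fun i => ?_
  rw [Real.dist_eq, abs_le, boxClamp]
  constructor
  · linarith [le_max_left (x₀ i - ρ) (min (x₀ i + ρ) (y i))]
  · rw [sub_le_iff_le_add']
    exact max_le (by linarith) (min_le_left _ _)

theorem boxClamp_of_mem {ι : Type*} [Fintype ι] {x₀ : ι → ℝ} {ρ : ℝ} {y : ι → ℝ}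
    (hy : y ∈ Metric.closedBall x₀ ρ) : boxClamp x₀ ρ y = y := by
  funext i
  have h1 := (dist_le_pi_dist y x₀ i).trans (Metric.mem_closedBall.1 hy)
  rw [Real.dist_eq, abs_le] at h1
  rw [boxClamp, min_eq_right (by linarith), max_eq_right (by linarith)]

/-- Only `h` is assumed to stay in the ball where the field is Lipschitz; as long as `g` agrees with
`h`, it stays there for some more time. -/
theorem eqOn_Ico_of_lipschitzOnWith_closedBall {E : Type*} [NormedAddCommGroup E] [NormedSpace ℝ E]
    {X : E → E} {x₀ : E} {ρ : ℝ} {K : NNReal} (hX : LipschitzOnWith K X (Metric.closedBall x₀ ρ))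
    {g h : ℝ → E} {τ : ℝ} (h0 : g 0 = h 0)
    (hg : ∀ t ∈ Ico 0 τ, HasDerivWithinAt g (X (g t)) (Ico 0 τ) t)
    (hh : ∀ t ∈ Ico 0 τ, HasDerivWithinAt h (X (h t)) (Ico 0 τ) t)
    (hmem : ∀ t ∈ Ico 0 τ, h t ∈ Metric.ball x₀ ρ) : EqOn g h (Ico 0 τ) := by
  intro T hT
  have hsub : Icc 0 T ⊆ Ico 0 τ := Icc_subset_Ico_right hT.2
  have hgc : ContinuousOn g (Ico 0 τ) := fun t ht => (hg t ht).continuousWithinAt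
  have hhc : ContinuousOn h (Ico 0 τ) := fun t ht => (hh t ht).continuousWithinAt
  have hcl : IsClosed ({t | g t = h t} ∩ Icc 0 T) := by
    have : {t | g t = h t} ∩ Icc 0 T = Icc 0 T ∩ (fun t => g t - h t) ⁻¹' {0} := by
      ext t; simp [sub_eq_zero, and_comm]
    rw [this]
    exact ((hgc.mono hsub).sub (hhc.mono hsub)).preimage_isClosed_of_isClosed isClosed_Icc
      isClosed_singleton
  refine hcl.Icc_subset_of_forall_mem_nhdsWithin h0 (fun t ht => ?_) ⟨hT.1, le_rfl⟩
  obtain ⟨hgt, ht0, htT⟩ := ht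
  have htτ : t < τ := htT.trans hT.2
  have hright : Ico 0 τ ∈ 𝓝[≥] t :=
    mem_of_superset (Ico_mem_nhdsGE htτ) (Ico_subset_Ico_left ht0)
  have hball : Metric.ball x₀ ρ ∈ 𝓝 (h t) := Metric.isOpen_ball.mem_nhds (hmem t ⟨ht0, htτ⟩)
  have hge : ∀ᶠ s in 𝓝[≥] t, g s ∈ Metric.ball x₀ ρ := by
    have h1 := ((hgc t ⟨ht0, htτ⟩).mono_of_mem_nhdsWithin hright)
    refine h1.eventually_mem ?_
    rw [show g t = h t from hgt]; exact hball
  obtain ⟨u, hu, husub⟩ := mem_nhdsGE_iff_exists_Icc_subset.1 (inter_mem hge hright)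
  have hu' : t < u := hu
  have huI : Icc t u ⊆ Ico 0 τ := fun s hs => (husub hs).2
  have hder : ∀ {f : ℝ → E} (_ : ∀ t ∈ Ico 0 τ, HasDerivWithinAt f (X (f t)) (Ico 0 τ) t),
      ∀ s ∈ Ico t u, HasDerivWithinAt f (X (f s)) (Ici s) s := by
    intro f hf s hs
    have hs' := huI (Ico_subset_Icc_self hs)
    exact (hf s hs').mono_of_mem_nhdsWithin
      (mem_of_superset (Ico_mem_nhdsGE hs'.2) (Ico_subset_Ico_left hs'.1))
  have heq := ODE_solution_unique_of_mem_Icc_right (v := fun _ => X)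
    (s := fun _ => Metric.closedBall x₀ ρ) (fun _ _ => hX) (hgc.mono huI) (hder hg)
    (fun s hs => Metric.ball_subset_closedBall (husub (Ico_subset_Icc_self hs)).1) (hhc.mono huI)
    (hder hh)
    (fun s hs => Metric.ball_subset_closedBall (hmem s (huI (Ico_subset_Icc_self hs)))) hgt
  exact mem_of_superset (Ioc_mem_nhdsGT hu') fun s hs => heq (Ioc_subset_Icc_self hs)

/-- Lyapunov's theorem at a zero `x₀` of a `C¹` vector field `X`: if the linearized flow strictly
decreases the positive definite form `v ⬝ᵥ S v`, then the solutions that start near `x₀` exist for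
all times, are unique and converge to `x₀` exponentially. -/
theorem exists_exponentially_stable {ι : Type*} [Fintype ι] {X : (ι → ℝ) → ι → ℝ} {x₀ : ι → ℝ}
    {Ω : Set (ι → ℝ)} (hΩ : Ω ∈ 𝓝 x₀) (hX : ContDiffAt ℝ 1 X x₀) (hX0 : X x₀ = 0)
    (S : (ι → ℝ) →ₗ[ℝ] (ι → ℝ)) (hSs : ∀ v w, v ⬝ᵥ S w = w ⬝ᵥ S v)
    (hSp : ∀ v, v ≠ 0 → 0 < v ⬝ᵥ S v) (hneg : ∀ v, v ≠ 0 → S v ⬝ᵥ fderiv ℝ X x₀ v < 0) :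
    ∃ N ∈ 𝓝 x₀, ∃ C > 0, ∃ c > 0, ∀ y ∈ N, ∃ h : ℝ → ι → ℝ, h 0 = y ∧
      (∀ t ∈ Ici (0 : ℝ), h t ∈ Ω ∧ HasDerivWithinAt h (X (h t)) (Ici 0) t) ∧
      (∀ g : ℝ → ι → ℝ, ∀ τ, g 0 = y →
        (∀ t ∈ Ico 0 τ, HasDerivWithinAt g (X (g t)) (Ico 0 τ) t) → EqOn g h (Ico 0 τ)) ∧
      ∀ t ≥ 0, ‖h t - x₀‖ ≤ C * Real.exp (-(c * t)) := by
  set A := fderiv ℝ X x₀ with hA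
  obtain ⟨l, hl, hlow⟩ := exists_forall_mul_norm_sq_le S hSp
  have hSA : ∀ v, v ⬝ᵥ S (A v) = S v ⬝ᵥ A v := fun v =>
    (hSs v (A v)).trans (dotProduct_comm _ _)
  obtain ⟨m, hm, hdec⟩ := exists_forall_mul_norm_sq_le (-(S ∘ₗ (A : (ι → ℝ) →ₗ[ℝ] (ι → ℝ))))
    fun v hv => by simpa [hSA] using hneg v hv
  have hdec' : ∀ v, S v ⬝ᵥ A v ≤ -(m * ‖v‖ ^ 2) := fun v => by
    have h1 := hdec v
    simp only [LinearMap.neg_apply, LinearMap.comp_apply, dotProduct_neg,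
      ContinuousLinearMap.coe_coe, hSA] at h1
    linarith
  set σ := ‖LinearMap.toContinuousLinearMap S‖ with hσ
  have hσS : ∀ v, ‖S v‖ ≤ σ * ‖v‖ := (LinearMap.toContinuousLinearMap S).le_opNorm
  have hσ0 : 0 ≤ σ := norm_nonneg _
  set n : ℝ := (Fintype.card ι : ℝ) with hn
  have hn0 : 0 ≤ n := Nat.cast_nonneg _
  set L := n * σ + 1 with hL
  have hL0 : 0 < L := by positivity
  have hup : ∀ v, v ⬝ᵥ S v ≤ L * ‖v‖ ^ 2 := fun v => by
    have h1 := (le_abs_self _).trans (abs_dotProduct_le_card_mul v (S v))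
    have h2 : n * (‖v‖ * ‖S v‖) ≤ n * (‖v‖ * (σ * ‖v‖)) := by gcongr; exact hσS v
    nlinarith [sq_nonneg ‖v‖]
  -- near `x₀` the linear part dominates
  have hlin : ∀ᶠ x in 𝓝 x₀, ‖X x - A (x - x₀)‖ ≤ m / (2 * L) * ‖x - x₀‖ := by
    have := (hX.differentiableAt (by simp)).hasFDerivAt.isLittleO.def
      (show 0 < m / (2 * L) by positivity)
    simpa [hX0] using this
  obtain ⟨K, s, hs, hK⟩ := hX.exists_lipschitzOnWith
  obtain ⟨ρ, hρ, hsub⟩ := Metric.nhds_basis_closedBall.mem_iff.1 (inter_mem hΩ (inter_mem hs hlin))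
  have hLip : LipschitzOnWith K X (Metric.closedBall x₀ ρ) := hK.mono fun x hx => (hsub hx).2.1
  have hdiss : ∀ x ∈ Metric.closedBall x₀ ρ,
      2 * (S (x - x₀) ⬝ᵥ X x) ≤ -(m / L) * ((x - x₀) ⬝ᵥ S (x - x₀)) := by
    intro x hx
    have h1 : ‖X x - A (x - x₀)‖ ≤ m / (2 * L) * ‖x - x₀‖ := (hsub hx).2.2
    set v := x - x₀
    have h2 : S v ⬝ᵥ X x = S v ⬝ᵥ A v + S v ⬝ᵥ (X x - A v) := by
      rw [dotProduct_sub]; ring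
    have h3 := (le_abs_self _).trans (abs_dotProduct_le_card_mul (S v) (X x - A v))
    have h4 : n * (‖S v‖ * ‖X x - A v‖) ≤ n * (σ * ‖v‖ * (m / (2 * L) * ‖v‖)) := by
      gcongr; exact hσS v
    have h5 : n * (σ * ‖v‖ * (m / (2 * L) * ‖v‖)) ≤ m / 2 * ‖v‖ ^ 2 := by
      have : n * (σ * ‖v‖ * (m / (2 * L) * ‖v‖)) = (n * σ / L) * (m / 2 * ‖v‖ ^ 2) := by
        field_simp
      rw [this]
      refine mul_le_of_le_one_left (by positivity) ((div_le_one hL0).2 (by linarith))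
    have h6 : m / L * (v ⬝ᵥ S v) ≤ m * ‖v‖ ^ 2 := by
      calc m / L * (v ⬝ᵥ S v) ≤ m / L * (L * ‖v‖ ^ 2) := by gcongr; exact hup v
        _ = m * ‖v‖ ^ 2 := by field_simp
    have h7 := hdec' v
    rw [h2]
    linarith
  set w := l * ρ ^ 2 / 2 with hw
  have hw0 : 0 < w := by positivity
  have hball : ∀ v, v ⬝ᵥ S v ≤ w → ‖v‖ < ρ := fun v hv => by
    have h1 := hlow v
    refine lt_of_pow_lt_pow_left₀ 2 hρ.le ?_
    by_contra! h2
    have := mul_le_mul_of_nonneg_left h2 hl.le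
    nlinarith [mul_pos hl (pow_pos hρ 2)]
  have hSc : Continuous S := LinearMap.continuous_of_finiteDimensional S
  set c := m / (4 * L) with hc
  have hc0 : 0 < c := by positivity
  refine ⟨{y | (y - x₀) ⬝ᵥ S (y - x₀) < w}, ?_, √(w / l), by positivity, c, hc0, fun y hy => ?_⟩
  · refine IsOpen.mem_nhds (isOpen_lt (by fun_prop) continuous_const) ?_
    simpa using hw0
  -- solve for the field composed with the retraction onto the ball; the solution never leaves the
  -- ball, where this is `X`
  have hXt : LipschitzWith K (X ∘ boxClamp x₀ ρ) := by
    rw [← lipschitzOnWith_univ, ← mul_one K]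
    exact hLip.comp (lipschitzWith_boxClamp x₀ ρ).lipschitzOnWith fun z _ => boxClamp_mem x₀ hρ.le z
  have hXb : ∀ z, ‖(X ∘ boxClamp x₀ ρ) z‖ ≤ (K * ρ.toNNReal : NNReal) := fun z => by
    have h1 := boxClamp_mem x₀ hρ.le z
    have h2 := hLip.dist_le_mul _ h1 _ (Metric.mem_closedBall_self hρ.le)
    rw [hX0, dist_zero_right] at h2
    rw [NNReal.coe_mul, Real.coe_toNNReal _ hρ.le]
    exact h2.trans (mul_le_mul_of_nonneg_left h1 K.2)
  obtain ⟨h, h0, hder⟩ := exists_global_solution_of_bounded hXt hXb y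
  -- the decay rate `2 c` is half of the rate `m / L` of the Lyapunov inequality, which makes the
  -- comparison at the boundary strict
  have hWder : ∀ t, HasDerivAt (fun t => (h t - x₀) ⬝ᵥ S (h t - x₀))
      (2 * (S (h t - x₀) ⬝ᵥ (X ∘ boxClamp x₀ ρ) (h t))) t := by
    intro t
    have d1 : HasDerivAt (fun t => h t - x₀) ((X ∘ boxClamp x₀ ρ) (h t)) t := (hder t).sub_const x₀
    have d2 : HasDerivAt (fun t => S (h t - x₀)) (S ((X ∘ boxClamp x₀ ρ) (h t))) t :=
      (LinearMap.toContinuousLinearMap S).hasFDerivAt.comp_hasDerivAt t d1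
    have d3 : HasDerivAt (fun t => (h t - x₀) ⬝ᵥ S (h t - x₀)) _ t :=
      HasDerivAt.fun_sum fun i _ => (hasDerivAt_pi.1 d1 i).mul (hasDerivAt_pi.1 d2 i)
    refine d3.congr_deriv ?_
    rw [Finset.sum_add_distrib, two_mul]
    congr 1
    · exact dotProduct_comm _ _
    · exact (hSs _ _).trans (dotProduct_comm _ _)
  have hW : ∀ t ≥ 0, (h t - x₀) ⬝ᵥ S (h t - x₀) ≤ w * Real.exp (-(2 * c * t)) := by
    intro t ht
    have hB : ∀ t, HasDerivAt (fun t => w * Real.exp (-(2 * c * t)))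
        (w * (Real.exp (-(2 * c * t)) * -(2 * c * 1))) t := fun t =>
      (((hasDerivAt_id t).const_mul (2 * c)).neg.exp).const_mul w
    refine image_le_of_deriv_right_lt_deriv_boundary (a := 0) (b := t)
      (fun t _ => (hWder t).continuousAt.continuousWithinAt)
      (fun t _ => (hWder t).hasDerivWithinAt) ?_ hB (fun s hs hWs => ?_) ⟨ht, le_rfl⟩
    · rw [h0, mul_zero, neg_zero, Real.exp_zero, mul_one]; exact le_of_lt hy
    · have hs1 : w * Real.exp (-(2 * c * s)) ≤ w := by
        refine mul_le_of_le_one_right hw0.le (Real.exp_le_one_iff.2 ?_)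
        have := mul_nonneg hc0.le hs.1
        linarith
      have hmem : h s ∈ Metric.closedBall x₀ ρ := by
        rw [mem_closedBall_iff_norm]
        exact (hball _ (hWs.le.trans hs1)).le
      have h1 := hdiss _ hmem
      rw [Function.comp_apply, boxClamp_of_mem hmem]
      refine lt_of_le_of_lt h1 ?_
      rw [hWs]
      have h2 : 0 < w * Real.exp (-(2 * c * s)) := by positivity
      have h3 : m / L = 4 * c := by rw [hc]; field_simp
      rw [h3]
      nlinarith [mul_pos hc0 h2]
  have hWw : ∀ t ≥ 0, (h t - x₀) ⬝ᵥ S (h t - x₀) ≤ w := fun t ht => by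
    refine (hW t ht).trans (mul_le_of_le_one_right hw0.le (Real.exp_le_one_iff.2 ?_))
    have := mul_nonneg hc0.le ht
    linarith
  have hmem : ∀ t ≥ 0, h t ∈ Metric.ball x₀ ρ := fun t ht => by
    rw [mem_ball_iff_norm]; exact hball _ (hWw t ht)
  have hder' : ∀ t ≥ 0, HasDerivAt h (X (h t)) t := fun t ht => by
    have := hder t
    rwa [Function.comp_apply, boxClamp_of_mem (Metric.ball_subset_closedBall (hmem t ht))] at this
  refine ⟨h, h0, fun t ht => ⟨(hsub (Metric.ball_subset_closedBall (hmem t ht))).1,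
    (hder' t ht).hasDerivWithinAt⟩, fun g τ hg0 hg => ?_, fun t ht => ?_⟩
  · exact eqOn_Ico_of_lipschitzOnWith_closedBall hLip (hg0.trans h0.symm) hg
      (fun t ht => (hder' t ht.1).hasDerivWithinAt) fun t ht => hmem t ht.1
  · refine le_of_sq_le_sq ?_ (by positivity)
    rw [mul_pow, Real.sq_sqrt (by positivity), ← Real.exp_nat_mul]
    have h1 := (hlow _).trans (hW t ht)
    rw [show ((2 : ℕ) : ℝ) * -(c * t) = -(2 * c * t) by push_cast; ring, div_mul_eq_mul_div,
      le_div_iff₀ hl]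
    linarith

/-- The limit of a convergent solution is a zero of the field: by the mean value theorem the
increments `h (n + 1) - h n`, which tend to `0`, are values of the field along the solution. -/
theorem eq_zero_of_tendsto_of_hasDerivWithinAt {ι : Type*} [Fintype ι] {X : (ι → ℝ) → ι → ℝ}
    {h : ℝ → ι → ℝ} {p : ι → ℝ}
    (hh : ∀ t ∈ Ici (0 : ℝ), HasDerivWithinAt h (X (h t)) (Ici 0) t)
    (hp : Tendsto h atTop (𝓝 p)) (hX : ContinuousAt X p) : X p = 0 := by
  funext i
  have hmvt : ∀ n : ℕ, ∃ s : ℝ, (n : ℝ) ≤ s ∧ X (h s) i = h (n + 1) i - h n i := by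
    intro n
    have hn : (0 : ℝ) ≤ n := n.cast_nonneg
    obtain ⟨s, hs, hs'⟩ := exists_hasDerivAt_eq_slope (fun t => h t i) (fun t => X (h t) i)
      (lt_add_one (n : ℝ))
      (fun t ht => ((hasDerivWithinAt_pi.1 (hh t (hn.trans ht.1)) i).continuousWithinAt).mono
        fun r hr => hn.trans hr.1)
      fun t ht => (hasDerivWithinAt_pi.1 (hh t (hn.trans ht.1.le)) i).hasDerivAt
        (Ici_mem_nhds (hn.trans_lt ht.1))
    exact ⟨s, hs.1.le, by rw [hs']; simp⟩
  choose s hs hsX using hmvt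
  have hpi : Tendsto (fun t => h t i) atTop (𝓝 (p i)) := tendsto_pi_nhds.1 hp i
  have hcast : Tendsto (fun n : ℕ => (n : ℝ)) atTop atTop := tendsto_natCast_atTop_atTop
  have h1 : Tendsto (fun n => X (h (s n)) i) atTop (𝓝 (X p i)) :=
    ((continuous_apply i).continuousAt.tendsto.comp hX.tendsto).comp
      (hp.comp (tendsto_atTop_mono hs hcast))
  have h2 : Tendsto (fun n : ℕ => h (n + 1) i - h n i) atTop (𝓝 (p i - p i)) :=
    (hpi.comp (tendsto_atTop_add_const_right _ _ hcast)).sub (hpi.comp hcast)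
  simp only [hsX] at h1
  rw [tendsto_nhds_unique h1 h2, sub_self, Pi.zero_apply]

/-! ### Closeness in curvature, the two flows and their linearizations -/

theorem mul_exp_sub_mul_sub_nonneg {α B : ℝ} (hB : 0 ≤ α * B) (x y : ℝ) :
    0 ≤ (x - y) * (B * (Real.exp (α * x) - Real.exp (α * y))) := by
  rcases lt_trichotomy α 0 with h | rfl | h
  · have hB0 : B ≤ 0 := by
      by_contra! h0
      nlinarith [mul_pos (neg_pos.2 h) h0]
    rcases le_total x y with hxy | hxy
    · have h1 := Real.exp_le_exp.2 (mul_le_mul_of_nonpos_left hxy h.le)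
      exact mul_nonneg_of_nonpos_of_nonpos (by linarith)
        (mul_nonpos_of_nonpos_of_nonneg hB0 (by linarith))
    · have h1 := Real.exp_le_exp.2 (mul_le_mul_of_nonpos_left hxy h.le)
      exact mul_nonneg (by linarith) (mul_nonneg_of_nonpos_of_nonpos hB0 (by linarith))
  · simp
  · have hB0 : 0 ≤ B := nonneg_of_mul_nonneg_right hB h
    rcases le_total x y with hxy | hxy
    · have h1 := Real.exp_le_exp.2 (mul_le_mul_of_nonneg_left hxy h.le)
      exact mul_nonneg_of_nonpos_of_nonpos (by linarith)
        (mul_nonpos_of_nonneg_of_nonpos hB0 (by linarith))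
    · have h1 := Real.exp_le_exp.2 (mul_le_mul_of_nonneg_left hxy h.le)
      exact mul_nonneg (by linarith) (mul_nonneg hB0 (by linarith))

namespace DecoratedPHMetric

variable {V E F : Type*} {T : SurfaceTriangulation V E F} (M : DecoratedPHMetric T) [Fintype F]

theorem angleDefect_eq_mul_exp (α : ℝ) (h : V → ℝ) (i : V) :
    M.angleDefect h i = M.alphaCurvature α h i * Real.exp (α * h i) :=
  (div_mul_cancel₀ _ (Real.exp_pos _).ne').symm

variable [Fintype V]

/-- Factors with almost the curvature of `hbar` are close to `hbar`. One has
`K h - K hbar = (R h - R̄) exp (α h) + R̄ (exp (α h) - exp (α hbar))` and also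
`K h - K hbar = (R h - R̄) exp (α hbar) + R h (exp (α h) - exp (α hbar))`; paired with `h - hbar`
the last terms are nonnegative, and the first factors `exp` are bounded in the respective case. -/
theorem exists_mem_of_alphaCurvature_close {α : ℝ} {Rbar hbar : V → ℝ}
    (hbar_mem : hbar ∈ M.admissible) (hR : M.alphaCurvature α hbar = Rbar)
    (hα : ∀ i, 0 ≤ α * Rbar i) (hcase : α ≤ 0 ∨ ∀ i, 0 < Rbar i) {N : Set (V → ℝ)}
    (hN : N ∈ 𝓝 hbar) :
    ∃ δ > 0, ∀ h ∈ M.admissible, ‖M.alphaCurvature α h - M.alphaCurvature α hbar‖ < δ → h ∈ N := by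
  have : Nonempty V := by
    obtain ⟨f⟩ := T.nonempty
    exact ⟨T.vert f 0⟩
  obtain ⟨m, hm, hgap⟩ := M.exists_dotProduct_angleDefect_sub_le hbar_mem hN
  obtain ⟨ε, hε, hcase'⟩ : ∃ ε > 0, α ≤ 0 ∨ ∀ i, ε ≤ Rbar i := by
    rcases hcase with h | h
    · exact ⟨1, one_pos, Or.inl h⟩
    · obtain ⟨i, hi⟩ := Finite.exists_min Rbar
      exact ⟨Rbar i, h i, Or.inr hi⟩
  set e : V → ℝ := fun i => max 1 (Real.exp (α * hbar i)) with he
  have he0 : ∀ i, 0 < e i := fun i => lt_max_of_lt_left one_pos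
  set s := ∑ i, e i with hs
  have hs0 : 0 < s := Finset.sum_pos (fun i _ => he0 i) Finset.univ_nonempty
  refine ⟨min ε (m / (2 * s)), lt_min hε (by positivity), fun h hh hclose => ?_⟩
  by_contra hhN
  set d := min ε (m / (2 * s)) with hd
  have hterm : ∀ i, -(d * e i * ‖h - hbar‖) ≤
      (h i - hbar i) * (M.angleDefect h i - M.angleDefect hbar i) := by
    intro i
    have h1 : |M.alphaCurvature α h i - Rbar i| ≤ d := by
      have := norm_le_pi_norm (M.alphaCurvature α h - M.alphaCurvature α hbar) i
      rw [Pi.sub_apply, hR, Real.norm_eq_abs] at this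
      rw [hR] at hclose
      exact this.trans hclose.le
    have h2 : |h i - hbar i| ≤ ‖h - hbar‖ := norm_le_pi_norm (h - hbar) i
    have hfin : ∀ z : ℝ, 0 ≤ z → z ≤ e i → -(d * e i * ‖h - hbar‖) ≤
        (h i - hbar i) * ((M.alphaCurvature α h i - Rbar i) * z) := by
      intro z hz0 hz
      refine (abs_le.1 ?_).1
      rw [abs_mul, abs_mul, abs_of_nonneg hz0]
      calc |h i - hbar i| * (|M.alphaCurvature α h i - Rbar i| * z)
          ≤ ‖h - hbar‖ * (d * e i) := by gcongr
        _ = d * e i * ‖h - hbar‖ := by ring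
    rw [M.angleDefect_eq_mul_exp α h, M.angleDefect_eq_mul_exp α hbar, hR]
    rcases hcase' with h0 | h0
    · have h3 := hfin (Real.exp (α * h i)) (Real.exp_pos _).le (le_max_of_le_left
        (Real.exp_le_one_iff.2 (mul_nonpos_of_nonpos_of_nonneg h0 (hh.1 i).le)))
      have h4 := mul_exp_sub_mul_sub_nonneg (hα i) (h i) (hbar i)
      linarith
    · have h3 := hfin (Real.exp (α * hbar i)) (Real.exp_pos _).le (le_max_right _ _)
      have h5 : 0 ≤ M.alphaCurvature α h i := by
        have := (abs_le.1 h1).1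
        have := h0 i
        have := min_le_left ε (m / (2 * s))
        linarith
      have h6 : 0 ≤ α := by
        by_contra! h7
        nlinarith [hα i, h0 i, mul_pos (neg_pos.2 h7) (hε.trans_le (h0 i))]
      have h4 := mul_exp_sub_mul_sub_nonneg (mul_nonneg h6 h5) (h i) (hbar i)
      linarith
  have hsum : -(d * s * ‖h - hbar‖) ≤ (h - hbar) ⬝ᵥ (M.angleDefect h - M.angleDefect hbar) := by
    rw [hs, Finset.mul_sum, Finset.sum_mul, ← Finset.sum_neg_distrib]
    exact Finset.sum_le_sum fun i _ => hterm i
  have hle := hsum.trans (hgap h hh.1 hhN)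
  have hpos : 0 < ‖h - hbar‖ := by
    rw [norm_pos_iff, sub_ne_zero]
    rintro rfl
    exact hhN (mem_of_mem_nhds hN)
  have hds : d * s ≤ m / 2 := by
    calc d * s ≤ m / (2 * s) * s := by gcongr; exact min_le_right _ _
      _ = m / 2 := by field_simp
  nlinarith [mul_pos hm hpos, mul_le_mul_of_nonneg_right hds hpos.le]

theorem contDiffAt_ricciField {α : ℝ} {Rbar h : V → ℝ} (hh : h ∈ M.admissible)
    {n : WithTop ℕ∞} : ContDiffAt ℝ n (M.ricciField α Rbar) h := by
  refine contDiffAt_pi.2 fun i => ContDiffAt.sub (ContDiffAt.div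
    (contDiffAt_pi.1 (M.contDiffAt_angleDefect hh) i) ?_ (Real.exp_pos _).ne') contDiffAt_const
  exact (contDiffAt_const.mul (contDiff_apply ℝ ℝ i).contDiffAt).exp

theorem calabiField_eq {α : ℝ} {Rbar h : V → ℝ} (hh : h ∈ M.admissible) :
    M.calabiField α Rbar h = fun i =>
      -(1 / Real.exp (α * h i)) * fderiv ℝ M.angleDefect h (M.ricciField α Rbar h) i := by
  classical
  have hd := (M.contDiffAt_angleDefect hh (n := 1)).differentiableAt (by simp)
  have hpart : ∀ i j, M.angleDefectPartial h i j = fderiv ℝ M.angleDefect h (Pi.single j 1) i := by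
    intro i j
    have h1 := hasFDerivAt_pi'.1 hd.hasFDerivAt i
    rw [angleDefectPartial, h1.fderiv]
    simp only [ContinuousLinearMap.comp_apply, ContinuousLinearMap.proj_apply]
  funext i
  rw [calabiField, alphaLaplace]
  have hsum : ∀ φ : V → ℝ,
      ∑ j, M.angleDefectPartial h i j * φ j = fderiv ℝ M.angleDefect h φ i := by
    intro φ
    conv_rhs => rw [pi_eq_sum_univ' φ]
    simp [hpart, map_sum, mul_comm]
  rw [hsum]
  have : (fun j => Rbar j - M.alphaCurvature α h j) = -M.ricciField α Rbar h := by
    funext j; simp [ricciField]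
  rw [this, map_neg, Pi.neg_apply]
  ring

theorem contDiffAt_fderiv_angleDefect {h : V → ℝ} (hh : h ∈ M.admissible) :
    ContDiffAt ℝ 1 (fderiv ℝ M.angleDefect) h :=
  (M.contDiffAt_angleDefect hh (n := 2)).fderiv_right (by norm_num)

theorem contDiffAt_calabiField {α : ℝ} {Rbar h : V → ℝ} (hh : h ∈ M.admissible) :
    ContDiffAt ℝ 1 (M.calabiField α Rbar) h := by
  have h1 : ContDiffAt ℝ 1 (fun h i => -(1 / Real.exp (α * h i)) *
      fderiv ℝ M.angleDefect h (M.ricciField α Rbar h) i) h := by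
    refine contDiffAt_pi.2 fun i => ContDiffAt.mul ?_ ?_
    · exact (contDiffAt_const.div ((contDiffAt_const.mul
        (contDiff_apply ℝ ℝ i).contDiffAt).exp) (Real.exp_pos _).ne').neg
    · exact contDiffAt_pi.1 ((M.contDiffAt_fderiv_angleDefect hh).clm_apply
        (M.contDiffAt_ricciField hh)) i
  refine h1.congr_of_eventuallyEq ?_
  filter_upwards [M.isOpen_admissible.mem_nhds hh] with g hg using M.calabiField_eq hg

theorem fderiv_ricciField_apply {α : ℝ} {Rbar h : V → ℝ} (hh : h ∈ M.admissible) (v : V → ℝ)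
    (i : V) : fderiv ℝ (M.ricciField α Rbar) h v i =
      -(1 / Real.exp (α * h i)) *
        (-fderiv ℝ M.angleDefect h v i + α * M.angleDefect h i * v i) := by
  have hK := hasFDerivAt_pi'.1
    ((M.contDiffAt_angleDefect hh (n := 1)).differentiableAt (by simp)).hasFDerivAt i
  have hE : HasFDerivAt (fun g : V → ℝ => Real.exp (-(α * g i))) _ h :=
    ((hasFDerivAt_apply i h).const_mul α).neg.exp
  have hd := hasFDerivAt_pi'.1 ((M.contDiffAt_ricciField hh (α := α) (Rbar := Rbar)
    (n := 1)).differentiableAt (by simp)).hasFDerivAt i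
  have h2 := hd.unique (((hK.mul hE).sub_const (Rbar i)).congr_of_eventuallyEq
    (Eventually.of_forall fun g => by
      simp only [ricciField, alphaCurvature, Real.exp_neg, div_eq_mul_inv, Pi.mul_apply]))
  have h3 := congrArg (fun L => L v) h2
  simp only [ContinuousLinearMap.comp_apply, ContinuousLinearMap.proj_apply] at h3
  rw [h3]
  simp [Real.exp_neg]
  ring

/-- At a zero of the Ricci field, the derivatives of `∂K/∂h` and of `exp (-α h)` do not contribute
to the derivative of the Calabi field. -/
theorem fderiv_calabiField_apply {α : ℝ} {Rbar h : V → ℝ} (hh : h ∈ M.admissible)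
    (h0 : M.ricciField α Rbar h = 0) (v : V → ℝ) (i : V) :
    fderiv ℝ (M.calabiField α Rbar) h v i = -(1 / Real.exp (α * h i)) *
      fderiv ℝ M.angleDefect h (fderiv ℝ (M.ricciField α Rbar) h v) i := by
  have hE : HasFDerivAt (fun g : V → ℝ => -(1 / Real.exp (α * g i)))
      (fderiv ℝ (fun g : V → ℝ => -(1 / Real.exp (α * g i))) h) h := by
    refine DifferentiableAt.hasFDerivAt (ContDiffAt.differentiableAt (n := 1) ?_ (by simp))
    exact (contDiffAt_const.div ((contDiffAt_const.mul
        (contDiff_apply ℝ ℝ i).contDiffAt).exp) (Real.exp_pos _).ne').neg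
  have hR := ((M.contDiffAt_ricciField hh (α := α) (Rbar := Rbar)
    (n := 1)).differentiableAt (by simp)).hasFDerivAt
  have hL := ((M.contDiffAt_fderiv_angleDefect hh).differentiableAt (by simp)).hasFDerivAt
  have hLR := hasFDerivAt_pi'.1 (hL.clm_apply hR) i
  have hd := hasFDerivAt_pi'.1 ((M.contDiffAt_calabiField hh (α := α)
    (Rbar := Rbar)).differentiableAt (by simp)).hasFDerivAt i
  have h2 := hd.unique ((hE.mul hLR).congr_of_eventuallyEq (by
    filter_upwards [M.isOpen_admissible.mem_nhds hh] with g hg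
    rw [M.calabiField_eq hg]; rfl))
  have h3 := congrArg (fun L => L v) h2
  simp only [ContinuousLinearMap.comp_apply, ContinuousLinearMap.proj_apply] at h3
  rw [h3]
  simp [h0]

theorem calabiField_eq_zero {α : ℝ} {Rbar h : V → ℝ} (hh : h ∈ M.admissible)
    (h0 : M.calabiField α Rbar h = 0) : M.ricciField α Rbar h = 0 := by
  by_contra hne
  refine (M.fderiv_angleDefect_neg hh hne).ne ?_
  have : fderiv ℝ M.angleDefect h (M.ricciField α Rbar h) = 0 := by
    funext i
    have h1 := congrFun h0 i
    rw [M.calabiField_eq hh] at h1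
    simpa [(Real.exp_pos _).ne'] using h1
  rw [this, dotProduct_zero]

/-- The operator `S = -∂K/∂h + diag (α K)`. At a point where `R_α = R̄`, the linearization of the
Ricci flow is `-diag (exp (-α h)) S`, and `v ⬝ᵥ S v` is a Lyapunov function for both flows. -/
def lyapunovForm (α : ℝ) (h : V → ℝ) : (V → ℝ) →ₗ[ℝ] (V → ℝ) where
  toFun v i := -fderiv ℝ M.angleDefect h v i + α * M.angleDefect h i * v i
  map_add' v w := by funext i; simp only [map_add, Pi.add_apply]; ring
  map_smul' t v := by
    funext i; simp only [map_smul, Pi.smul_apply, smul_eq_mul, RingHom.id_apply]; ring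

theorem dotProduct_lyapunovForm (α : ℝ) (h v w : V → ℝ) :
    v ⬝ᵥ M.lyapunovForm α h w = -(v ⬝ᵥ fderiv ℝ M.angleDefect h w) +
      ∑ i, α * M.angleDefect h i * (v i * w i) := by
  simp only [dotProduct, lyapunovForm, LinearMap.coe_mk, AddHom.coe_mk, ← Finset.sum_neg_distrib,
    ← Finset.sum_add_distrib]
  exact Finset.sum_congr rfl fun i _ => by ring

theorem lyapunovForm_symm (α : ℝ) {h : V → ℝ} (hh : h ∈ M.admissible) (v w : V → ℝ) :
    v ⬝ᵥ M.lyapunovForm α h w = w ⬝ᵥ M.lyapunovForm α h v := by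
  rw [dotProduct_lyapunovForm, dotProduct_lyapunovForm, M.fderiv_angleDefect_symm hh]
  simp only [mul_comm (v _)]

theorem lyapunovForm_pos {α : ℝ} {h : V → ℝ} (hh : h ∈ M.admissible)
    (hK : ∀ i, 0 ≤ α * M.angleDefect h i) {v : V → ℝ} (hv : v ≠ 0) :
    0 < v ⬝ᵥ M.lyapunovForm α h v := by
  rw [dotProduct_lyapunovForm]
  have h1 := M.fderiv_angleDefect_neg hh hv
  have h2 : 0 ≤ ∑ i, α * M.angleDefect h i * (v i * v i) :=
    Finset.sum_nonneg fun i _ => mul_nonneg (hK i) (mul_self_nonneg _)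
  linarith

theorem lyapunovForm_ne_zero {α : ℝ} {h : V → ℝ} (hh : h ∈ M.admissible)
    (hK : ∀ i, 0 ≤ α * M.angleDefect h i) {v : V → ℝ} (hv : v ≠ 0) :
    M.lyapunovForm α h v ≠ 0 := fun h0 => by
  have := M.lyapunovForm_pos hh hK hv
  rw [h0, dotProduct_zero] at this
  exact lt_irrefl _ this

theorem fderiv_ricciField_eq {α : ℝ} {Rbar h : V → ℝ} (hh : h ∈ M.admissible) (v : V → ℝ) :
    fderiv ℝ (M.ricciField α Rbar) h v =
      fun i => -(1 / Real.exp (α * h i)) * M.lyapunovForm α h v i :=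
  funext fun i => M.fderiv_ricciField_apply hh v i

theorem lyapunovForm_dotProduct_fderiv_ricciField_neg {α : ℝ} {Rbar h : V → ℝ}
    (hh : h ∈ M.admissible) (hK : ∀ i, 0 ≤ α * M.angleDefect h i) {v : V → ℝ} (hv : v ≠ 0) :
    M.lyapunovForm α h v ⬝ᵥ fderiv ℝ (M.ricciField α Rbar) h v < 0 := by
  obtain ⟨i, hi⟩ := Function.ne_iff.1 (M.lyapunovForm_ne_zero hh hK hv)
  rw [M.fderiv_ricciField_eq hh]
  have hpos : ∀ j, 0 < 1 / Real.exp (α * h j) := fun j => one_div_pos.2 (Real.exp_pos _)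
  have hi' : 0 < M.lyapunovForm α h v i ^ 2 := by simpa using pow_pos (abs_pos.2 hi) 2
  refine Finset.sum_neg' (fun j _ => ?_) ⟨i, Finset.mem_univ i, ?_⟩
  · nlinarith [mul_nonneg (hpos j).le (sq_nonneg (M.lyapunovForm α h v j))]
  · nlinarith [mul_pos (hpos i) hi']

theorem lyapunovForm_dotProduct_fderiv_calabiField_neg {α : ℝ} {Rbar h : V → ℝ}
    (hh : h ∈ M.admissible) (h0 : M.ricciField α Rbar h = 0)
    (hK : ∀ i, 0 ≤ α * M.angleDefect h i) {v : V → ℝ} (hv : v ≠ 0) :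
    M.lyapunovForm α h v ⬝ᵥ fderiv ℝ (M.calabiField α Rbar) h v < 0 := by
  set u := fderiv ℝ (M.ricciField α Rbar) h v with hu
  have hu0 : u ≠ 0 := by
    intro hu0
    have := M.lyapunovForm_dotProduct_fderiv_ricciField_neg hh hK hv (Rbar := Rbar)
    rw [← hu, hu0, dotProduct_zero] at this
    exact lt_irrefl _ this
  refine lt_of_eq_of_lt ?_ (M.fderiv_angleDefect_neg hh hu0)
  refine Finset.sum_congr rfl fun i _ => ?_
  rw [M.fderiv_calabiField_apply hh h0, ← hu, hu, M.fderiv_ricciField_eq hh]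
  ring

end DecoratedPHMetric

end

theorem theorem2p4 {V E F : Type*} [Fintype V] [Fintype F]
    (T : SurfaceTriangulation V E F) (M : DecoratedPHMetric T) (α : ℝ) (Rbar : V → ℝ) :
    -- (i) the limit of a convergent flow has `α`-curvature `Rbar`
    (∀ X ∈ ({M.ricciField α Rbar, M.calabiField α Rbar} : Set ((V → ℝ) → V → ℝ)),
      ∀ h : ℝ → V → ℝ, M.IsSolutionOn X (Ici 0) h →
      ∀ hbar ∈ M.admissible, Tendsto h atTop (𝓝 hbar) → M.alphaCurvature α hbar = Rbar) ∧
    -- (ii) local exponential convergence of both flows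
    (∀ hbar ∈ M.admissible, M.alphaCurvature α hbar = Rbar → (∀ i, 0 ≤ α * Rbar i) →
      ∃ U ∈ 𝓝 hbar, (α ≤ 0 ∨ (∀ i, 0 < Rbar i) → U = univ) ∧
      ∃ δ > 0, ∃ C > 0, ∃ c > 0,
      ∀ h₀ ∈ M.admissible ∩ U, ‖M.alphaCurvature α h₀ - M.alphaCurvature α hbar‖ < δ →
      ∀ X ∈ ({M.ricciField α Rbar, M.calabiField α Rbar} : Set ((V → ℝ) → V → ℝ)),
      ∃ h : ℝ → V → ℝ, h 0 = h₀ ∧ M.IsSolutionOn X (Ici 0) h ∧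
        (∀ g : ℝ → V → ℝ, ∀ τ > 0, g 0 = h₀ → M.IsSolutionOn X (Ico 0 τ) g →
          EqOn g h (Ico 0 τ)) ∧
        ∀ t ≥ 0, ‖h t - hbar‖ ≤ C * Real.exp (-(c * t))) := by
  constructor
  · intro X hX h hsol hbar hbar_mem hlim
    have hzero : ContinuousAt X hbar → X hbar = 0 :=
      eq_zero_of_tendsto_of_hasDerivWithinAt (fun t ht => (hsol t ht).2) hlim
    suffices hric : M.ricciField α Rbar hbar = 0 from
      funext fun i => sub_eq_zero.1 (congrFun hric i)
    rcases hX with rfl | rfl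
    · exact hzero (M.contDiffAt_ricciField hbar_mem (n := 0)).continuousAt
    · exact M.calabiField_eq_zero hbar_mem
        (hzero (M.contDiffAt_calabiField hbar_mem).continuousAt)
  · intro hbar hbar_mem hR hα
    have hric : M.ricciField α Rbar hbar = 0 := by
      funext i; simp [DecoratedPHMetric.ricciField, hR]
    have hcal : M.calabiField α Rbar hbar = 0 := by
      rw [M.calabiField_eq hbar_mem, hric]; funext i; simp
    have hK : ∀ i, 0 ≤ α * M.angleDefect hbar i := fun i => by
      rw [M.angleDefect_eq_mul_exp α, hR, ← mul_assoc]
      exact mul_nonneg (hα i) (Real.exp_pos _).le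
    have hΩ := M.isOpen_admissible.mem_nhds hbar_mem
    obtain ⟨N₁, hN₁, C₁, hC₁, c₁, hc₁, H₁⟩ := exists_exponentially_stable hΩ
      (M.contDiffAt_ricciField hbar_mem) hric (M.lyapunovForm α hbar)
      (M.lyapunovForm_symm α hbar_mem) (fun v => M.lyapunovForm_pos hbar_mem hK)
      (fun v => M.lyapunovForm_dotProduct_fderiv_ricciField_neg hbar_mem hK)
    obtain ⟨N₂, hN₂, C₂, hC₂, c₂, hc₂, H₂⟩ := exists_exponentially_stable hΩ
      (M.contDiffAt_calabiField hbar_mem) hcal (M.lyapunovForm α hbar)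
      (M.lyapunovForm_symm α hbar_mem) (fun v => M.lyapunovForm_pos hbar_mem hK)
      (fun v => M.lyapunovForm_dotProduct_fderiv_calabiField_neg hbar_mem hric hK)
    obtain ⟨U, hU, hUuniv, δ, hδ, hUδ⟩ : ∃ U ∈ 𝓝 hbar, (α ≤ 0 ∨ (∀ i, 0 < Rbar i) → U = univ) ∧
        ∃ δ > 0, ∀ h₀ ∈ M.admissible ∩ U,
          ‖M.alphaCurvature α h₀ - M.alphaCurvature α hbar‖ < δ → h₀ ∈ N₁ ∩ N₂ := by
      by_cases hcase : α ≤ 0 ∨ ∀ i, 0 < Rbar i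
      · obtain ⟨δ, hδ, h1⟩ := M.exists_mem_of_alphaCurvature_close hbar_mem hR hα hcase
          (inter_mem hN₁ hN₂)
        exact ⟨univ, univ_mem, fun _ => rfl, δ, hδ, fun h₀ h => h1 h₀ h.1⟩
      · exact ⟨N₁ ∩ N₂, inter_mem hN₁ hN₂, fun h => absurd h hcase, 1, one_pos,
          fun h₀ h _ => h.2⟩
    refine ⟨U, hU, hUuniv, δ, hδ, max C₁ C₂, lt_max_of_lt_left hC₁, min c₁ c₂, lt_min hc₁ hc₂,
      fun h₀ hh₀ hclose X hX => ?_⟩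
    have hmem := hUδ h₀ hh₀ hclose
    have hweak : ∀ {C c t : ℝ}, C ≤ max C₁ C₂ → min c₁ c₂ ≤ c → 0 < C → 0 ≤ t →
        C * Real.exp (-(c * t)) ≤ max C₁ C₂ * Real.exp (-(min c₁ c₂ * t)) := by
      intro C c t hC hc hC0 ht
      gcongr
    rcases hX with rfl | rfl
    · obtain ⟨h, h0, hsol, huniq, hexp⟩ := H₁ h₀ hmem.1
      exact ⟨h, h0, hsol, fun g τ _ hg0 hg => huniq g τ hg0 fun t ht => (hg t ht).2,
        fun t ht => (hexp t ht).trans (hweak (le_max_left _ _) (min_le_left _ _) hC₁ ht)⟩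
    · obtain ⟨h, h0, hsol, huniq, hexp⟩ := H₂ h₀ hmem.2
      exact ⟨h, h0, hsol, fun g τ _ hg0 hg => huniq g τ hg0 fun t ht => (hg t ht).2,
        fun t ht => (hexp t ht).trans (hweak (le_max_right _ _) (min_le_right _ _) hC₂ ht)⟩
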